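/- **Conventions.** All function spaces are on $(0,\infty)$. An r.i. space $E$ is a rearrangement invariant Banach function space on $((0,\infty),dt)$ with the Fatou property (Bennett–Sharpley axioms; $f^*\le g^*$ implies $\|f\|_E\le\|g\|_E$). $\widetilde E$ is the corresponding r.i. space with respect to the measure $dt/t$, i.e. $\|f\|_{\widetilde E}=\|f^{*}\|_E$ with the non-increasing rearrangement $f^*$ of $f$ taken with respect to $dt/t$; for an interval $I\subset(0,\infty)$, $\|f\|_{\widetilde E(I)}=\|f\chi_I\|_{\widetilde E}$. A measurable $\mathrm b:(0,\infty)\to(0,\infty)$ is slowly varying ($\mathrm b\in SV$) if for each $\varepsilon>0$ the function $t^{\varepsilon}\mathrm b(t)$ is equivalent (up to positive constant factors) to a non-decreasing function and $t^{-\varepsilon}\mathrm b(t)$ is equivalent to a non-increasing function. Let $\overline X=(X_0,X_1)$ be a compatible couple of (quasi-)Banach spaces, i.e. both are continuously embedded in a Hausdorff topological vector space, and let $$K(t,f)=K(t,f;X_0,X_1)=\inf\{\|f_0\|_{X_0}+t\|f_1\|_{X_1}: f=f_0+f_1,\ f_i\in X_i\}$$ be the Peetre $K$-functional. For $0<\theta<1$,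 $a,\mathrm b\in SV$ and r.i. spaces $E,F$, let $\overline X^{\mathcal L}_{\theta,\mathrm b,E,a,F}$ and $\overline X^{\mathcal R}_{\theta,\mathrm b,E,a,F}$ be the spaces of all $f\in X_0+X_1$ with finite (quasi-)norm, respectively, $$\Big\|\mathrm b(t)\,\|s^{-\theta}a(s)K(s,f)\|_{\widetilde F(0,t)}\Big\|_{\widetilde E},\qquad \Big\|\mathrm b(t)\,\|s^{-\theta}a(s)K(s,f)\|_{\widetilde F(t,\infty)}\Big\|_{\widetilde E}.$$ **Theorem.** Let $0<\theta_0<\theta_1<1$, let $E_0,E_1,F_0,F_1$ be r.i. spaces and let $a_0,a_1,\mathrm b_0,\mathrm b_1\in SV$ be such that $\|\mathrm b_0\|_{\widetilde E_0(1,\infty)}<\infty$ and $\|\mathrm b_1\|_{\widetilde E_1(0,1)}<\infty$. Put $$\rho(u)=u^{\theta_1-\theta_0}\,\frac{a_0(u)\,\|\mathrm b_0\|_{\widetilde E_0(u,\infty)}}{a_1(u)\,\|\mathrm b_1\|_{\widetilde E_1(0,u)}},\qquad u>0,$$ and $Y_0=\overline X^{\mathcal L}_{\theta_0,\mathrm b_0,E_0,a_0,F_0}$,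 $Y_1=\overline X^{\mathcal R}_{\theta_1,\mathrm b_1,E_1,a_1,F_1}$. Then $0<\rho(u)<\infty$ for every $u>0$, and, for every $f\in Y_0+Y_1$ and every $u>0$, $$\begin{aligned}K(\rho(u),f;Y_0,Y_1)\sim{}&\Big\|\mathrm b_0(t)\,\|s^{-\theta_0}a_0(s)K(s,f)\|_{\widetilde F_0(0,t)}\Big\|_{\widetilde E_0(0,u)}\\&+\|\mathrm b_0\|_{\widetilde E_0(u,\infty)}\,\|t^{-\theta_0}a_0(t)K(t,f)\|_{\widetilde F_0(0,u)}\\&+\rho(u)\,\|\mathrm b_1\|_{\widetilde E_1(0,u)}\,\|t^{-\theta_1}a_1(t)K(t,f)\|_{\widetilde F_1(u,\infty)}\\&+\rho(u)\,\Big\|\mathrm b_1(t)\,\|s^{-\theta_1}a_1(s)K(s,f)\|_{\widetilde F_1(t,\infty)}\Big\|_{\widetilde E_1(u,\infty)},\end{aligned}$$ where $\sim$ means that each side is at most $C$ times the other, with a constant $C>0$ independent of $f$ and $u$. -/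

import Mathlib

open MeasureTheory Set Filter Topology
open scoped ENNReal NNReal

/-- Lebesgue measure on the half-line `(0, ∞)`. -/
noncomputable def lebHalfLine : Measure ℝ := volume.restrict (Ioi 0)

/-- The homogeneous measure `dt / t` on the half-line `(0, ∞)`. -/
noncomputable def homHalfLine : Measure ℝ :=
  (volume.restrict (Ioi 0)).withDensity (fun t => ENNReal.ofReal t⁻¹)

/-- The non-increasing rearrangement `f*(t) = inf {l ≥ 0 : μ {f > l} ≤ t}` of a nonnegative
function with respect to the measure `μ`. -/
noncomputable def rearrangement (μ : Measure ℝ) (f : ℝ → ℝ≥0∞) (t : ℝ) : ℝ≥0∞ :=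
  sInf {l : ℝ≥0∞ | μ {x | l < f x} ≤ ENNReal.ofReal t}

/-- A rearrangement invariant Banach function space on `(0, ∞)` with Lebesgue measure, given by
its Banach function norm (with the Fatou property) on nonnegative measurable functions; the
space consists of the measurable `f` with `nrm |f| < ∞`. -/
structure RISpace where
  /-- The function norm, `∞` outside the space. -/
  nrm : (ℝ → ℝ≥0∞) → ℝ≥0∞
  nrm_eq_zero_iff : ∀ f, AEMeasurable f lebHalfLine → (nrm f = 0 ↔ f =ᵐ[lebHalfLine] 0)
  nrm_const_mul : ∀ (c : ℝ≥0) (f), AEMeasurable f lebHalfLine →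
    nrm (fun x => (c : ℝ≥0∞) * f x) = c * nrm f
  nrm_triangle : ∀ f g, AEMeasurable f lebHalfLine → AEMeasurable g lebHalfLine →
    nrm (fun x => f x + g x) ≤ nrm f + nrm g
  nrm_mono : ∀ f g, AEMeasurable f lebHalfLine → AEMeasurable g lebHalfLine →
    f ≤ᵐ[lebHalfLine] g → nrm f ≤ nrm g
  /-- The Fatou property. -/
  nrm_iSup : ∀ f : ℕ → ℝ → ℝ≥0∞, (∀ n, AEMeasurable (f n) lebHalfLine) →
    (∀ᵐ x ∂lebHalfLine, Monotone fun n => f n x) →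
    nrm (fun x => ⨆ n, f n x) = ⨆ n, nrm (f n)
  nrm_indicator_lt_top : ∀ s : Set ℝ, MeasurableSet s → lebHalfLine s < ∞ →
    nrm (s.indicator fun _ => 1) < ∞
  lintegral_le : ∀ s : Set ℝ, MeasurableSet s → lebHalfLine s < ∞ →
    ∃ C : ℝ≥0, ∀ f, AEMeasurable f lebHalfLine → ∫⁻ x in s, f x ∂lebHalfLine ≤ C * nrm f
  /-- Rearrangement invariance. -/
  nrm_le_of_rearrangement_le : ∀ f g, AEMeasurable f lebHalfLine → AEMeasurable g lebHalfLine →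
    (∀ t, 0 < t → rearrangement lebHalfLine f t ≤ rearrangement lebHalfLine g t) →
    nrm f ≤ nrm g

/-- The norm of the counterpart `Ẽ` of `E` with respect to the measure `dt / t`: the `E`-norm
of the rearrangement taken with respect to `dt / t`. -/
noncomputable def RISpace.tildeNorm (E : RISpace) (f : ℝ → ℝ≥0∞) : ℝ≥0∞ :=
  E.nrm (rearrangement homHalfLine f)

/-- The norm of `Ẽ(I)`, for an interval `I` in `(0, ∞)`. -/
noncomputable def RISpace.tildeNormOn (E : RISpace) (I : Set ℝ) (f : ℝ → ℝ≥0∞) : ℝ≥0∞ :=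
  E.tildeNorm (I.indicator f)

/-- Slowly varying functions on `(0, ∞)` (only the values on `(0, ∞)` matter). -/
structure SlowlyVarying (b : ℝ → ℝ) : Prop where
  aemeasurable : AEMeasurable b lebHalfLine
  pos : ∀ t, 0 < t → 0 < b t
  equiv_monotone : ∀ ε : ℝ, 0 < ε → ∃ g : ℝ → ℝ, MonotoneOn g (Ioi 0) ∧
    ∃ c C : ℝ, 0 < c ∧ 0 < C ∧ ∀ t, 0 < t → c * g t ≤ t ^ ε * b t ∧ t ^ ε * b t ≤ C * g t
  equiv_antitone : ∀ ε : ℝ, 0 < ε → ∃ g : ℝ → ℝ, AntitoneOn g (Ioi 0) ∧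
    ∃ c C : ℝ, 0 < c ∧ 0 < C ∧ ∀ t, 0 < t → c * g t ≤ t ^ (-ε) * b t ∧ t ^ (-ε) * b t ≤ C * g t

/-- A quasi-Banach space continuously embedded in the topological vector space `V`: the subspace
`{x | qnorm x < ∞}` with the quasi-norm `qnorm`. -/
structure QuasiBanachIn (𝕜 V : Type*) [RCLike 𝕜] [AddCommGroup V] [Module 𝕜 V]
    [TopologicalSpace V] where
  /-- The quasi-norm, `∞` outside the space. -/
  qnorm : V → ℝ≥0∞
  qnorm_eq_zero_iff : ∀ x, qnorm x = 0 ↔ x = 0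
  qnorm_smul : ∀ (c : 𝕜) (x : V), qnorm (c • x) = ‖c‖ₑ * qnorm x
  quasi_triangle : ∃ C : ℝ≥0, ∀ x y, qnorm (x + y) ≤ C * (qnorm x + qnorm y)
  complete : ∀ x : ℕ → V, (∀ n, qnorm (x n) < ∞) →
    (∀ ε : ℝ≥0∞, 0 < ε → ∃ k, ∀ m n, k ≤ m → k ≤ n → qnorm (x m - x n) < ε) →
    ∃ y, qnorm y < ∞ ∧ Tendsto (fun n => qnorm (x n - y)) atTop (𝓝 0)
  /-- The inclusion into `V` is continuous (at zero, hence everywhere). -/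
  continuous_embedding : ∀ U ∈ 𝓝 (0 : V), ∃ ε : ℝ≥0∞, 0 < ε ∧ ∀ x, qnorm x < ε → x ∈ U

section Couples

variable {V : Type*} [AddCommGroup V]

/-- The sum `X₀ + X₁` of the spaces `Xᵢ = {x | Nᵢ x < ∞}`. -/
def sumSpace (N₀ N₁ : V → ℝ≥0∞) : Set V :=
  {f | ∃ f₀ f₁, N₀ f₀ < ∞ ∧ N₁ f₁ < ∞ ∧ f = f₀ + f₁}

/-- The Peetre `K`-functional `K(t, f; X₀, X₁)`, where `Xᵢ = {x | Nᵢ x < ∞}`. -/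
noncomputable def peetreK (N₀ N₁ : V → ℝ≥0∞) (t : ℝ≥0∞) (f : V) : ℝ≥0∞ :=
  ⨅ (f₀ : V) (f₁ : V) (_ : N₀ f₀ < ∞ ∧ N₁ f₁ < ∞ ∧ f = f₀ + f₁), N₀ f₀ + t * N₁ f₁

/-- The function `s ↦ s ^ (-θ) a(s) K(s, f)`. -/
noncomputable def weightedK (N₀ N₁ : V → ℝ≥0∞) (θ : ℝ) (a : ℝ → ℝ) (f : V) (s : ℝ) : ℝ≥0∞ :=
  ENNReal.ofReal (s ^ (-θ)) * ENNReal.ofReal (a s) * peetreK N₀ N₁ (ENNReal.ofReal s) f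

open Classical in
/-- The quasi-norm of `(X₀, X₁)^ℒ_{θ,b,E,a,F}`, with value `∞` outside the space. -/
noncomputable def normL (N₀ N₁ : V → ℝ≥0∞) (θ : ℝ) (b : ℝ → ℝ) (E : RISpace) (a : ℝ → ℝ)
    (F : RISpace) (f : V) : ℝ≥0∞ :=
  if f ∈ sumSpace N₀ N₁ then
    E.tildeNorm fun t =>
      ENNReal.ofReal (b t) * F.tildeNormOn (Ioo 0 t) (weightedK N₀ N₁ θ a f)
  else ∞

open Classical in
/-- The quasi-norm of `(X₀, X₁)^ℛ_{θ,b,E,a,F}`, with value `∞` outside the space. -/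
noncomputable def normR (N₀ N₁ : V → ℝ≥0∞) (θ : ℝ) (b : ℝ → ℝ) (E : RISpace) (a : ℝ → ℝ)
    (F : RISpace) (f : V) : ℝ≥0∞ :=
  if f ∈ sumSpace N₀ N₁ then
    E.tildeNorm fun t =>
      ENNReal.ofReal (b t) * F.tildeNormOn (Ioi t) (weightedK N₀ N₁ θ a f)
  else ∞

end Couples

/-! Write T₀(u) for the norm of b₀ over (u,∞) and T₁(u) for the norm of b₁ over (0,u). Since dt/t is
invariant under dilations and inversion, so is every norm Ẽ. Two consequences carry the proof. A
positive power times a slowly varying weight has norm over (0,u) at most a constant times its value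
at u, and likewise for a negative power over (u,∞) (`exists_tildeNormOn_rpow_mul_le`). Conversely,
K(s,f) changes by at most a factor 2 when s does, so the value of s^(-θ)a(s)K(s,f) at u is
controlled by its norm over either side of u (`exists_powerWeight_le`).

Upper bound for the K-functional of (Y₀,Y₁): split f = g + h almost optimally for K(u,f;X₀,X₁)
(`exists_decomposition`). Up to constants, K(s,g) is at most K(s,f) for s ≤ u and at most K(u,f)
beyond, while K(s,h) is at most (s/u)K(u,f) for s ≤ u and at most K(s,f) beyond. The replaced pieces
are pure powers times a slowly varying weight, so the two facts absorb them into the inner norms at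
u. This bounds g in Y₀ by the first two terms (`exists_left_upper`) and h in Y₁ by the last two
(`exists_right_upper`).

Lower bound: let f = g + h with g in Y₀ and h in Y₁. The ℒ-terms of g and the ℛ-terms of h are at
most twice the respective norms. For the cross terms, the norm of h in Y₁ gives the pointwise bound
s^(-θ₁)a₁(s)K(s,h) ≲ ‖h‖/T₁(s). With θ₀ in place of θ₁ this becomes a bound by s^(θ₁-θ₀) times a
slowly varying weight, and the first fact evaluates its ℒ-terms at u as ρ(u)‖h‖
(`exists_leftTerm_le_of_le`). The bound for g is symmetric (`exists_rightTerm_le_of_le`). The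
function ρ is exactly the weight that this computation produces. -/

/-! ### The measure dt/t and its invariances -/

section HomogeneousMeasure

theorem measurePreserving_exp : MeasurePreserving Real.exp volume homHalfLine := by
  refine ⟨Real.measurable_exp, ?_⟩
  ext s hs
  rw [Measure.map_apply Real.measurable_exp hs, homHalfLine, withDensity_apply _ hs,
    Measure.restrict_restrict hs]
  have himg : s ∩ Ioi 0 = Real.exp '' (Real.exp ⁻¹' s) := by
    rw [image_preimage_eq_inter_range, Real.range_exp]
  rw [himg, lintegral_image_eq_lintegral_abs_deriv_mul (hs.preimage Real.measurable_exp)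
    (fun x _ => (Real.hasDerivAt_exp x).hasDerivWithinAt) Real.exp_injective.injOn]
  have : ∀ x : ℝ, ENNReal.ofReal |Real.exp x| * ENNReal.ofReal (Real.exp x)⁻¹ = 1 := by
    intro x
    rw [abs_of_pos (Real.exp_pos x), ← ENNReal.ofReal_mul (Real.exp_pos x).le,
      mul_inv_cancel₀ (Real.exp_pos x).ne', ENNReal.ofReal_one]
  simp_rw [this]
  simp

theorem ae_homHalfLine_pos_ne (u : ℝ) : ∀ᵐ x ∂homHalfLine, 0 < x ∧ x ≠ u := by
  have hac : homHalfLine ≪ volume.restrict (Ioi 0) := withDensity_absolutelyContinuous _ _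
  refine hac.ae_le ?_
  filter_upwards [ae_restrict_mem measurableSet_Ioi,
    ae_restrict_of_ae (Measure.ae_ne volume u)] with x hx hxu
  exact ⟨hx, hxu⟩

theorem homHalfLine_absolutelyContinuous : homHalfLine ≪ lebHalfLine :=
  withDensity_absolutelyContinuous _ _

theorem homHalfLine_Ioo {a b : ℝ} (ha : 0 < a) (hb : 0 < b) :
    homHalfLine (Ioo a b) = ENNReal.ofReal (Real.log b - Real.log a) := by
  rw [← measurePreserving_exp.measure_preimage measurableSet_Ioo.nullMeasurableSet]
  have : Real.exp ⁻¹' Ioo a b = Ioo (Real.log a) (Real.log b) := by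
    ext x
    simp [Real.log_lt_iff_lt_exp ha, Real.lt_log_iff_exp_lt hb]
  rw [this, Real.volume_Ioo]

/-- In logarithmic coordinates a dilation is a translation. Because the dilation is a measurable
embedding, the equality holds for arbitrary sets, which spares measurability hypotheses when norms
are dilated. -/
theorem homHalfLine_preimage_mul {c : ℝ} (hc : 0 < c) (s : Set ℝ) :
    homHalfLine ((fun x => c * x) ⁻¹' s) = homHalfLine s := by
  have h : MeasurePreserving (fun x : ℝ => c * x) homHalfLine homHalfLine := by
    refine ⟨measurable_const_mul c, ?_⟩
    rw [← measurePreserving_exp.map_eq, Measure.map_map (measurable_const_mul c)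
      Real.measurable_exp]
    have : (fun x => c * x) ∘ Real.exp = Real.exp ∘ fun x => Real.log c + x := by
      ext x
      simp [Real.exp_add, Real.exp_log hc]
    rw [this, ← Measure.map_map Real.measurable_exp (measurable_const_add _),
      (measurePreserving_add_left volume (Real.log c)).map_eq]
  exact h.measure_preimage_emb (measurableEmbedding_mulLeft₀ hc.ne') s

theorem homHalfLine_preimage_inv (s : Set ℝ) :
    homHalfLine ((fun x => x⁻¹) ⁻¹' s) = homHalfLine s := by
  have h : MeasurePreserving (fun x : ℝ => x⁻¹) homHalfLine homHalfLine := by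
    refine ⟨measurable_inv, ?_⟩
    rw [← measurePreserving_exp.map_eq, Measure.map_map measurable_inv Real.measurable_exp]
    have : (fun x => x⁻¹) ∘ Real.exp = Real.exp ∘ fun x => -x := by
      ext x
      simp [Real.exp_neg]
    rw [this, ← Measure.map_map Real.measurable_exp measurable_neg,
      (Measure.measurePreserving_neg (volume : Measure ℝ)).map_eq]
  exact h.measure_preimage_emb (MeasurableEquiv.inv ℝ).measurableEmbedding s

/-- The unit intervals [n, n+1) with n natural are translated onto those with n an integer,
following a bijection of ℕ with ℤ. -/
theorem exists_measurePreserving_halfLine_real :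
    ∃ S : ℝ → ℝ, MeasurePreserving S lebHalfLine volume := by
  obtain ⟨e⟩ : Nonempty (ℕ ≃ ℤ) := ⟨(Denumerable.eqv ℤ).symm⟩
  let S : ℝ → ℝ := fun x => x + ((e ⌊x⌋₊ : ℝ) - ⌊x⌋₊)
  have hS : Measurable S := by
    refine measurable_id.add ?_
    exact (measurable_from_nat (f := fun n : ℕ => (e n : ℝ) - n)).comp Nat.measurable_floor
  refine ⟨S, hS, ?_⟩
  have hU : Ici (0 : ℝ) = ⋃ n : ℕ, Ico (n : ℝ) (n + 1) := by
    ext x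
    simp only [mem_Ici, mem_iUnion, mem_Ico]
    exact ⟨fun hx => ⟨⌊x⌋₊, Nat.floor_le hx, Nat.lt_floor_add_one x⟩,
      fun ⟨n, hn, _⟩ => (Nat.cast_nonneg n).trans hn⟩
  have hdN : Pairwise (Function.onFun Disjoint fun n : ℕ => Ico (n : ℝ) (n + 1)) := by
    intro m n hmn
    have := pairwise_disjoint_Ico_intCast ℝ (Nat.cast_injective.ne hmn : (m : ℤ) ≠ n)
    simpa [Function.onFun] using this
  have hleb : lebHalfLine = Measure.sum fun n : ℕ => volume.restrict (Ico (n : ℝ) (n + 1)) := by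
    rw [lebHalfLine, restrict_Ioi_eq_restrict_Ici, hU,
      Measure.restrict_iUnion hdN fun _ => measurableSet_Ico]
  have hvol : (volume : Measure ℝ) =
      Measure.sum fun n : ℤ => volume.restrict (Ico (n : ℝ) (n + 1)) := by
    rw [← Measure.restrict_iUnion (pairwise_disjoint_Ico_intCast ℝ)
      fun _ => measurableSet_Ico, iUnion_Ico_intCast, Measure.restrict_univ]
  have hpiece : ∀ n : ℕ, (volume.restrict (Ico (n : ℝ) (n + 1))).map S =
      volume.restrict (Ico ((e n : ℤ) : ℝ) (e n + 1)) := by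
    intro n
    have h1 : S =ᵐ[volume.restrict (Ico (n : ℝ) (n + 1))] fun x => x + ((e n : ℝ) - n) := by
      filter_upwards [ae_restrict_mem measurableSet_Ico] with x hx
      have : ⌊x⌋₊ = n := (Nat.floor_eq_iff ((Nat.cast_nonneg n).trans hx.1)).2 ⟨hx.1, hx.2⟩
      simp [S, this]
    rw [Measure.map_congr h1]
    have h2 := (measurePreserving_add_right volume ((e n : ℝ) - n)).restrict_preimage
      (measurableSet_Ico (a := ((e n : ℤ) : ℝ)) (b := (e n : ℝ) + 1))
    have h3 : (fun x : ℝ => x + ((e n : ℝ) - n)) ⁻¹' Ico ((e n : ℤ) : ℝ) (e n + 1) =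
        Ico (n : ℝ) (n + 1) := by
      rw [preimage_add_const_Ico]
      congr 1 <;> ring
    rw [h3] at h2
    exact h2.map_eq
  rw [hleb, Measure.map_sum hS.aemeasurable]
  refine Eq.trans ?_ hvol.symm
  simp_rw [hpiece]
  ext s hs
  rw [Measure.sum_apply _ hs, Measure.sum_apply _ hs]
  exact e.tsum_eq fun n : ℤ => volume.restrict (Ico (n : ℝ) (n + 1)) s

theorem exists_measurePreserving_halfLine :
    ∃ T : ℝ → ℝ, MeasurePreserving T lebHalfLine homHalfLine := by
  obtain ⟨S, hS⟩ := exists_measurePreserving_halfLine_real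
  exact ⟨Real.exp ∘ S, measurePreserving_exp.comp hS⟩

end HomogeneousMeasure

/-! ### Rearrangements and equimeasurability -/

section Rearrangement

variable {μ ν : Measure ℝ} {f g : ℝ → ℝ≥0∞}

theorem rearrangement_congr (h : ∀ l, μ {x | l < f x} = ν {x | l < g x}) :
    rearrangement μ f = rearrangement ν g := by
  funext t
  simp only [rearrangement, h]

theorem rearrangement_mono (h : f ≤ᵐ[μ] g) (t : ℝ) :
    rearrangement μ f t ≤ rearrangement μ g t := by
  refine sInf_le_sInf fun l hl => le_trans (measure_mono_ae ?_) hl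
  filter_upwards [h] with x hx hlx
  exact lt_of_lt_of_le hlx hx

theorem antitone_rearrangement : Antitone (rearrangement μ f) := fun _ _ hst =>
  sInf_le_sInf fun _ hl => le_trans hl (ENNReal.ofReal_le_ofReal hst)

theorem measurable_rearrangement : Measurable (rearrangement μ f) :=
  antitone_rearrangement.measurable

/-- The distribution function is right-continuous: {f > l} is the increasing union of the sets {f >
v n} with `v n` decreasing to l, so a strict inequality at l persists at some slightly higher level.
-/
theorem lt_rearrangement_iff {l : ℝ≥0∞} {t : ℝ} :
    l < rearrangement μ f t ↔ ENNReal.ofReal t < μ {x | l < f x} := by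
  constructor
  · intro h
    by_contra! h'
    exact absurd (sInf_le (show l ∈ {l : ℝ≥0∞ | μ {x | l < f x} ≤ ENNReal.ofReal t} from h'))
      (not_le.2 h)
  · intro h
    have hl : l < ⊤ := by
      by_contra! hl
      simp [top_le_iff.1 hl] at h
    obtain ⟨v, hv, hvl, hvt⟩ := exists_seq_strictAnti_tendsto' hl
    have hU : {x | l < f x} = ⋃ n, {x | v n < f x} := by
      ext x
      simp only [mem_ofPred_eq, mem_iUnion]
      exact ⟨fun hx => (hvt.eventually_lt_const hx).exists,
        fun ⟨n, hn⟩ => (hvl n).1.trans hn⟩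
    have hmono : Monotone fun n => {x | v n < f x} := fun m n hmn x hx =>
      lt_of_le_of_lt (hv.antitone hmn) hx
    rw [hU, hmono.measure_iUnion, lt_iSup_iff] at h
    obtain ⟨n, hn⟩ := h
    refine (hvl n).1.trans_le (le_sInf fun m hm => ?_)
    by_contra! hmn
    exact absurd (hn.trans_le ((measure_mono fun x hx => hmn.trans hx).trans hm))
      (lt_irrefl _)

theorem lebHalfLine_lt_rearrangement (l : ℝ≥0∞) :
    lebHalfLine {t | l < rearrangement μ f t} = μ {x | l < f x} := by
  simp only [lt_rearrangement_iff]
  generalize μ {x | l < f x} = d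
  have hm : MeasurableSet {t : ℝ | ENNReal.ofReal t < d} :=
    measurableSet_lt ENNReal.measurable_ofReal measurable_const
  rw [lebHalfLine, Measure.restrict_apply hm]
  induction d with
  | top =>
    simp
  | coe d =>
    have : {t : ℝ | ENNReal.ofReal t < d} ∩ Ioi 0 = Ioo 0 (d : ℝ) := by
      ext t
      simp only [mem_inter_iff, mem_ofPred_eq, mem_Ioi, mem_Ioo]
      constructor
      · rintro ⟨h1, h2⟩
        refine ⟨h2, ?_⟩
        rwa [← ENNReal.ofReal_coe_nnreal, ENNReal.ofReal_lt_ofReal_iff_of_nonneg h2.le] at h1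
      · rintro ⟨h1, h2⟩
        refine ⟨?_, h1⟩
        rwa [← ENNReal.ofReal_coe_nnreal, ENNReal.ofReal_lt_ofReal_iff_of_nonneg h1.le]
    rw [this, Real.volume_Ioo, sub_zero, ENNReal.ofReal_coe_nnreal]

theorem rearrangement_const_mul_le {c : ℝ≥0} (hc : c ≠ 0) (t : ℝ) :
    rearrangement μ (fun x => c * f x) t ≤ c * rearrangement μ f t := by
  have hc' : (c : ℝ≥0∞) ≠ 0 := by exact_mod_cast hc
  rw [← ENNReal.inv_mul_le_iff hc' ENNReal.coe_ne_top]
  refine le_sInf fun l hl => ?_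
  rw [ENNReal.inv_mul_le_iff hc' ENNReal.coe_ne_top]
  refine sInf_le (le_trans (measure_mono fun x hx => ?_) hl)
  exact lt_of_mul_lt_mul_left (show (c : ℝ≥0∞) * l < c * f x from hx) (zero_le)

end Rearrangement

/-! ### The norms Ẽ: homogeneity, dilations, triangle inequality, Fatou property -/

namespace RISpace

variable (E : RISpace) {f g : ℝ → ℝ≥0∞} {I J : Set ℝ}

theorem tildeNorm_mono_ae (h : f ≤ᵐ[homHalfLine] g) : E.tildeNorm f ≤ E.tildeNorm g :=
  E.nrm_mono _ _ measurable_rearrangement.aemeasurable measurable_rearrangement.aemeasurable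
    (Eventually.of_forall fun t => rearrangement_mono h t)

theorem tildeNorm_mono (h : ∀ x, 0 < x → f x ≤ g x) : E.tildeNorm f ≤ E.tildeNorm g :=
  E.tildeNorm_mono_ae ((ae_homHalfLine_pos_ne 0).mono fun x hx => h x hx.1)

theorem tildeNormOn_mono (h : ∀ x, 0 < x → x ∈ I → f x ≤ g x) :
    E.tildeNormOn I f ≤ E.tildeNormOn I g :=
  E.tildeNorm_mono fun x hx => by
    by_cases hI : x ∈ I
    · simpa [hI] using h x hx hI
    · simp [hI]

theorem tildeNormOn_mono_set (h : I ⊆ J) (f : ℝ → ℝ≥0∞) :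
    E.tildeNormOn I f ≤ E.tildeNormOn J f :=
  E.tildeNorm_mono fun x _ => indicator_le_indicator_of_subset h (fun _ => zero_le) x

theorem tildeNormOn_le_tildeNorm (I : Set ℝ) (f : ℝ → ℝ≥0∞) :
    E.tildeNormOn I f ≤ E.tildeNorm f :=
  E.tildeNorm_mono fun x _ => indicator_le_self I f x

theorem tildeNorm_const_mul_le_of_ne_zero {c : ℝ≥0} (hc : c ≠ 0) (f : ℝ → ℝ≥0∞) :
    E.tildeNorm (fun x => c * f x) ≤ c * E.tildeNorm f := by
  unfold tildeNorm
  rw [← E.nrm_const_mul c _ measurable_rearrangement.aemeasurable]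
  exact E.nrm_mono _ _ measurable_rearrangement.aemeasurable
    (measurable_rearrangement.const_mul _).aemeasurable
    (Eventually.of_forall fun t => rearrangement_const_mul_le hc t)

theorem tildeNorm_zero : E.tildeNorm (fun _ => 0) = 0 := by
  unfold tildeNorm
  rw [E.nrm_eq_zero_iff _ measurable_rearrangement.aemeasurable]
  refine Eventually.of_forall fun t => ?_
  simp [rearrangement]

theorem tildeNorm_coe_mul (c : ℝ≥0) (f : ℝ → ℝ≥0∞) :
    E.tildeNorm (fun x => c * f x) = c * E.tildeNorm f := by
  rcases eq_or_ne c 0 with rfl | hc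
  · simp [tildeNorm_zero]
  refine le_antisymm (E.tildeNorm_const_mul_le_of_ne_zero hc f) ?_
  have hc' : (c : ℝ≥0∞) ≠ 0 := by exact_mod_cast hc
  have h := E.tildeNorm_const_mul_le_of_ne_zero (inv_ne_zero hc) fun x => c * f x
  have h2 : (fun x => ((c⁻¹ : ℝ≥0) : ℝ≥0∞) * (c * f x)) = f := by
    funext x
    rw [ENNReal.coe_inv hc, ← mul_assoc, ENNReal.inv_mul_cancel hc' ENNReal.coe_ne_top, one_mul]
  rw [h2, ENNReal.coe_inv hc] at h
  rw [mul_comm]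
  rwa [← ENNReal.le_div_iff_mul_le (Or.inl hc') (Or.inl ENNReal.coe_ne_top), div_eq_mul_inv,
    mul_comm]

theorem mul_tildeNorm_le (c : ℝ≥0∞) (f : ℝ → ℝ≥0∞) :
    c * E.tildeNorm f ≤ E.tildeNorm fun x => c * f x := by
  induction c with
  | coe c => exact (E.tildeNorm_coe_mul c f).ge
  | top =>
    -- An infinite factor is the supremum of the natural numbers, each covered by the finite case.
    rw [← ENNReal.iSup_natCast, ENNReal.iSup_mul]
    refine iSup_le fun n => ?_
    have := E.tildeNorm_coe_mul n f
    simp only [ENNReal.coe_natCast] at this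
    rw [← this]
    exact E.tildeNorm_mono fun x _ => by gcongr; exact le_iSup (fun n : ℕ => (n : ℝ≥0∞)) n

/-- Infinite factors occur later because inner norms may be infinite. When the norm of f is nonzero,
the right-hand side is then infinite. -/
theorem tildeNorm_const_mul_le {c : ℝ≥0∞} (h : c ≠ ⊤ ∨ E.tildeNorm f ≠ 0) :
    E.tildeNorm (fun x => c * f x) ≤ c * E.tildeNorm f := by
  induction c with
  | coe c => exact (E.tildeNorm_coe_mul c f).le
  | top => simp [ENNReal.top_mul (h.resolve_left (by simp))]

theorem indicator_const_mul (I : Set ℝ) (c : ℝ≥0∞) (f : ℝ → ℝ≥0∞) :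
    (I.indicator fun x => c * f x) = fun x => c * I.indicator f x := by
  funext x
  by_cases hx : x ∈ I <;> simp [hx]

theorem mul_tildeNormOn_le (c : ℝ≥0∞) (f : ℝ → ℝ≥0∞) :
    c * E.tildeNormOn I f ≤ E.tildeNormOn I fun x => c * f x := by
  unfold tildeNormOn
  rw [indicator_const_mul]
  exact E.mul_tildeNorm_le _ _

theorem tildeNormOn_const_mul_le {c : ℝ≥0∞} (h : c ≠ ⊤ ∨ E.tildeNormOn I f ≠ 0) :
    E.tildeNormOn I (fun x => c * f x) ≤ c * E.tildeNormOn I f := by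
  unfold tildeNormOn
  rw [indicator_const_mul]
  exact E.tildeNorm_const_mul_le h

theorem tildeNorm_comp_mul {c : ℝ} (hc : 0 < c) (f : ℝ → ℝ≥0∞) :
    E.tildeNorm (fun x => f (c * x)) = E.tildeNorm f := by
  unfold tildeNorm
  rw [rearrangement_congr (g := f) fun l => homHalfLine_preimage_mul hc {x | l < f x}]

theorem tildeNorm_comp_inv (f : ℝ → ℝ≥0∞) :
    E.tildeNorm (fun x => f x⁻¹) = E.tildeNorm f := by
  unfold tildeNorm
  rw [rearrangement_congr (g := f) fun l => homHalfLine_preimage_inv {x | l < f x}]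

theorem tildeNormOn_Ioo_comp_mul {c u : ℝ} (hc : 0 < c) (f : ℝ → ℝ≥0∞) :
    E.tildeNormOn (Ioo 0 u) (fun x => f (c * x)) = E.tildeNormOn (Ioo 0 (c * u)) f := by
  unfold tildeNormOn
  rw [← E.tildeNorm_comp_mul hc ((Ioo 0 (c * u)).indicator f)]
  congr 1
  funext x
  simp [indicator, hc]

theorem tildeNormOn_Ioi_comp_mul {c u : ℝ} (hc : 0 < c) (f : ℝ → ℝ≥0∞) :
    E.tildeNormOn (Ioi u) (fun x => f (c * x)) = E.tildeNormOn (Ioi (c * u)) f := by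
  unfold tildeNormOn
  rw [← E.tildeNorm_comp_mul hc ((Ioi (c * u)).indicator f)]
  congr 1
  funext x
  simp [indicator, hc]

/-- Both f* and f ∘ T are equimeasurable with f. Unlike f ↦ f*, composition with T is additive and
commutes with suprema, so the triangle inequality and the Fatou property of E pass to Ẽ. -/
theorem tildeNorm_eq_nrm_comp {T : ℝ → ℝ} (hT : MeasurePreserving T lebHalfLine homHalfLine)
    (hf : AEMeasurable f homHalfLine) : E.tildeNorm f = E.nrm (f ∘ T) := by
  have h : rearrangement lebHalfLine (rearrangement homHalfLine f) =
      rearrangement lebHalfLine (f ∘ T) := by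
    refine rearrangement_congr fun l => ?_
    rw [lebHalfLine_lt_rearrangement]
    exact (hT.measure_preimage (nullMeasurableSet_lt aemeasurable_const hf)).symm
  have hfT : AEMeasurable (f ∘ T) lebHalfLine := hf.comp_quasiMeasurePreserving
    hT.quasiMeasurePreserving
  exact le_antisymm
    (E.nrm_le_of_rearrangement_le _ _ measurable_rearrangement.aemeasurable hfT
      fun t _ => (congrFun h t).le)
    (E.nrm_le_of_rearrangement_le _ _ hfT measurable_rearrangement.aemeasurable
      fun t _ => (congrFun h t).ge)

theorem tildeNorm_add_le (hf : AEMeasurable f homHalfLine) (hg : AEMeasurable g homHalfLine) :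
    E.tildeNorm (fun x => f x + g x) ≤ E.tildeNorm f + E.tildeNorm g := by
  obtain ⟨T, hT⟩ := exists_measurePreserving_halfLine
  rw [E.tildeNorm_eq_nrm_comp hT hf, E.tildeNorm_eq_nrm_comp hT hg,
    E.tildeNorm_eq_nrm_comp hT (f := fun x => f x + g x) (hf.add hg)]
  exact E.nrm_triangle _ _ (hf.comp_quasiMeasurePreserving hT.quasiMeasurePreserving)
    (hg.comp_quasiMeasurePreserving hT.quasiMeasurePreserving)

theorem tildeNormOn_add_le (hI : MeasurableSet I) (hf : AEMeasurable f homHalfLine)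
    (hg : AEMeasurable g homHalfLine) :
    E.tildeNormOn I (fun x => f x + g x) ≤ E.tildeNormOn I f + E.tildeNormOn I g := by
  unfold tildeNormOn
  rw [show (I.indicator fun x => f x + g x) = fun x => I.indicator f x + I.indicator g x from
    indicator_add I f g]
  exact E.tildeNorm_add_le (hf.indicator hI) (hg.indicator hI)

theorem tildeNorm_iSup {f : ℕ → ℝ → ℝ≥0∞} (hf : ∀ n, AEMeasurable (f n) homHalfLine)
    (hmono : ∀ x, Monotone fun n => f n x) :
    E.tildeNorm (fun x => ⨆ n, f n x) = ⨆ n, E.tildeNorm (f n) := by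
  obtain ⟨T, hT⟩ := exists_measurePreserving_halfLine
  rw [E.tildeNorm_eq_nrm_comp hT (AEMeasurable.iSup hf)]
  simp_rw [fun n => E.tildeNorm_eq_nrm_comp hT (hf n)]
  exact E.nrm_iSup (fun n => f n ∘ T)
    (fun n => (hf n).comp_quasiMeasurePreserving hT.quasiMeasurePreserving)
    (Eventually.of_forall fun x => hmono (T x))

theorem tildeNorm_indicator_lt_top {s : Set ℝ} (hs : MeasurableSet s) (h : homHalfLine s < ∞) :
    E.tildeNorm (s.indicator fun _ => 1) < ∞ := by
  obtain ⟨T, hT⟩ := exists_measurePreserving_halfLine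
  rw [E.tildeNorm_eq_nrm_comp hT (measurable_const.indicator hs).aemeasurable]
  refine E.nrm_indicator_lt_top (T ⁻¹' s) (hT.measurable hs) ?_
  rwa [hT.measure_preimage hs.nullMeasurableSet]

theorem tildeNorm_indicator_ne_zero {s : Set ℝ} (hs : MeasurableSet s) (h : homHalfLine s ≠ 0) :
    E.tildeNorm (s.indicator fun _ => 1) ≠ 0 := by
  obtain ⟨T, hT⟩ := exists_measurePreserving_halfLine
  have hm : Measurable (s.indicator fun _ => (1 : ℝ≥0∞)) := measurable_const.indicator hs
  rw [E.tildeNorm_eq_nrm_comp hT hm.aemeasurable, Ne,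
    E.nrm_eq_zero_iff _ (hm.comp hT.measurable).aemeasurable]
  intro h0
  refine h ?_
  rw [← hT.measure_preimage hs.nullMeasurableSet]
  refine measure_mono_null (fun x (hx : T x ∈ s) => ?_) (ae_iff.1 h0)
  simp [hx]

theorem tildeNormOn_Ioo_mono (f : ℝ → ℝ≥0∞) : Monotone fun t => E.tildeNormOn (Ioo 0 t) f :=
  fun _ _ h => E.tildeNormOn_mono_set (Ioo_subset_Ioo_right h) f

theorem tildeNormOn_Ioi_anti (f : ℝ → ℝ≥0∞) : Antitone fun t => E.tildeNormOn (Ioi t) f :=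
  fun _ _ h => E.tildeNormOn_mono_set (Ioi_subset_Ioi h) f

end RISpace

/-! ### Slowly varying weights and their stability -/

/-- Extended nonnegative slowly varying weights on `(0, ∞)`, through the two-point estimates
equivalent to almost monotonicity of `t ^ ε * w t` and of `t ^ (-ε) * w t`. -/
def IsSlowWeight (w : ℝ → ℝ≥0∞) : Prop :=
  ∀ ε : ℝ, 0 < ε → ∃ C : ℝ≥0, C ≠ 0 ∧ ∀ s t, 0 < s → s ≤ t →
    w s ≤ C * ENNReal.ofReal ((t / s) ^ ε) * w t ∧ w t ≤ C * ENNReal.ofReal ((t / s) ^ ε) * w s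

theorem div_rpow_half_mul_self {s t ε : ℝ} (hs : 0 < s) (hst : s ≤ t) :
    ENNReal.ofReal ((t / s) ^ (ε / 2)) * ENNReal.ofReal ((t / s) ^ (ε / 2)) =
      ENNReal.ofReal ((t / s) ^ ε) := by
  have : 0 < t / s := div_pos (hs.trans_le hst) hs
  rw [← ENNReal.ofReal_mul (by positivity), ← Real.rpow_add this]
  congr 2
  ring

theorem SlowlyVarying.isSlowWeight {b : ℝ → ℝ} (hb : SlowlyVarying b) :
    IsSlowWeight fun t => ENNReal.ofReal (b t) := by
  intro ε hε
  obtain ⟨g, hg, c, C, hc, hC, hgb⟩ := hb.equiv_monotone ε hε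
  obtain ⟨h, hh, c', C', hc', hC', hhb⟩ := hb.equiv_antitone ε hε
  have hD : 0 < max (C / c) (C' / c') := lt_max_of_lt_left (div_pos hC hc)
  -- Passing from s to t through the monotone comparison function costs C/c; passing back through
  -- the antitone one costs C'/c'.
  refine ⟨(max (C / c) (C' / c')).toNNReal, (Real.toNNReal_pos.2 hD).ne', fun s t hs hst => ?_⟩
  have ht := hs.trans_le hst
  have key : ∀ x y k p q : ℝ, 0 < p → 0 < q → 0 < y → k ≤ max (C / c) (C' / c') →
      p * x ≤ k * (q * y) → q / p = (t / s) ^ ε →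
      ENNReal.ofReal x ≤ ((max (C / c) (C' / c')).toNNReal : ℝ≥0∞) *
        ENNReal.ofReal ((t / s) ^ ε) * ENNReal.ofReal y := by
    intro x y k p q hp hq hy hk hxy hpq
    change _ ≤ ENNReal.ofReal _ * _ * _
    rw [← ENNReal.ofReal_mul hD.le, ← ENNReal.ofReal_mul (by positivity), ← hpq]
    refine ENNReal.ofReal_le_ofReal ?_
    rw [mul_div_assoc', div_mul_eq_mul_div, le_div_iff₀ hp]
    calc x * p = p * x := mul_comm _ _
      _ ≤ k * (q * y) := hxy
      _ ≤ max (C / c) (C' / c') * (q * y) := by gcongr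
      _ = _ := by ring
  constructor
  · refine key _ _ (C / c) (s ^ ε) (t ^ ε) (by positivity) (by positivity) (hb.pos t ht)
      (le_max_left _ _) ?_ (Real.div_rpow ht.le hs.le ε).symm
    calc s ^ ε * b s ≤ C * g s := (hgb s hs).2
      _ ≤ C * g t := by gcongr; exact hg hs ht hst
      _ = C / c * (c * g t) := by field_simp
      _ ≤ C / c * (t ^ ε * b t) := mul_le_mul_of_nonneg_left (hgb t ht).1 (by positivity)
  · refine key _ _ (C' / c') (t ^ (-ε)) (s ^ (-ε)) (by positivity) (by positivity) (hb.pos s hs)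
      (le_max_right _ _) ?_ ?_
    · calc t ^ (-ε) * b t ≤ C' * h t := (hhb t ht).2
        _ ≤ C' * h s := by gcongr; exact hh hs ht hst
        _ = C' / c' * (c' * h s) := by field_simp
        _ ≤ C' / c' * (s ^ (-ε) * b s) := mul_le_mul_of_nonneg_left (hhb s hs).1 (by positivity)
    · rw [Real.div_rpow ht.le hs.le, Real.rpow_neg hs.le, Real.rpow_neg ht.le]
      field_simp

theorem IsSlowWeight.mul {v w : ℝ → ℝ≥0∞} (hv : IsSlowWeight v) (hw : IsSlowWeight w) :
    IsSlowWeight fun t => v t * w t := by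
  intro ε hε
  obtain ⟨C, hC0, hC⟩ := hv (ε / 2) (half_pos hε)
  obtain ⟨D, hD0, hD⟩ := hw (ε / 2) (half_pos hε)
  refine ⟨C * D, mul_ne_zero hC0 hD0, fun s t hs hst => ?_⟩
  rw [← div_rpow_half_mul_self hs hst, ENNReal.coe_mul]
  constructor
  · refine (mul_le_mul' (hC s t hs hst).1 (hD s t hs hst).1).trans (le_of_eq ?_)
    ring
  · refine (mul_le_mul' (hC s t hs hst).2 (hD s t hs hst).2).trans (le_of_eq ?_)
    ring

theorem IsSlowWeight.inv {w : ℝ → ℝ≥0∞} (hw : IsSlowWeight w) : IsSlowWeight fun t => (w t)⁻¹ := by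
  intro ε hε
  obtain ⟨C, hC0, hC⟩ := hw ε hε
  refine ⟨C, hC0, fun s t hs hst => ?_⟩
  have ht := hs.trans_le hst
  have hpos : 0 < (t / s) ^ ε := by positivity
  have key : ∀ x y k : ℝ≥0∞, k ≠ 0 → k ≠ ⊤ → x ≤ k * y → y⁻¹ ≤ k * x⁻¹ := by
    intro x y k h0 h1 h
    rw [← ENNReal.inv_mul_le_iff h0 h1, ← ENNReal.mul_inv (Or.inl h0) (Or.inl h1)]
    exact ENNReal.inv_le_inv.2 h
  have h0 : (C : ℝ≥0∞) * ENNReal.ofReal ((t / s) ^ ε) ≠ 0 :=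
    mul_ne_zero (by exact_mod_cast hC0) (by simpa using hpos)
  have h1 : (C : ℝ≥0∞) * ENNReal.ofReal ((t / s) ^ ε) ≠ ⊤ :=
    ENNReal.mul_ne_top ENNReal.coe_ne_top ENNReal.ofReal_ne_top
  exact ⟨key _ _ _ h0 h1 (hC s t hs hst).2, key _ _ _ h0 h1 (hC s t hs hst).1⟩

theorem IsSlowWeight.ne_top {w : ℝ → ℝ≥0∞} (hw : IsSlowWeight w) {s t : ℝ} (hs : 0 < s)
    (ht : 0 < t) (h : w s ≠ ⊤) : w t ≠ ⊤ := by
  obtain ⟨C, -, hC⟩ := hw 1 one_pos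
  have hk : ∀ r : ℝ, (C : ℝ≥0∞) * ENNReal.ofReal r * w s ≠ ⊤ := fun r =>
    ENNReal.mul_ne_top (ENNReal.mul_ne_top ENNReal.coe_ne_top ENNReal.ofReal_ne_top) h
  rcases le_total s t with hst | hst
  · exact ne_top_of_le_ne_top (hk _) (hC s t hs hst).2
  · exact ne_top_of_le_ne_top (hk _) (hC t s ht hst).1

theorem IsSlowWeight.doubling {w : ℝ → ℝ≥0∞} (hw : IsSlowWeight w) :
    ∃ C : ℝ≥0, ∀ s u, 0 < s → 0 < u → s ≤ 2 * u → u ≤ 2 * s → w u ≤ C * w s := by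
  obtain ⟨C, -, hC⟩ := hw 1 one_pos
  have key : ∀ x y : ℝ, 0 < x → y ≤ 2 * x → ENNReal.ofReal ((y / x) ^ (1 : ℝ)) ≤ 2 := by
    intro x y hx hxy
    rw [Real.rpow_one]
    refine (ENNReal.ofReal_le_ofReal ((div_le_iff₀ hx).2 hxy)).trans (by simp)
  refine ⟨C * 2, fun s u hs hu h1 h2 => ?_⟩
  push_cast
  rcases le_total s u with h | h
  · exact (hC s u hs h).2.trans (by gcongr; exact key _ _ hs h2)
  · exact (hC u s hu h).1.trans (by gcongr; exact key _ _ hu h1)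

/-- One inequality is monotonicity in the interval. For the other, the dilation by s/t turns the
norm over (s,∞) into one over (t,∞) and moves the argument of w by exactly the ratio t/s. -/
theorem IsSlowWeight.tildeNormOn_Ioi {w : ℝ → ℝ≥0∞} (hw : IsSlowWeight w) (E : RISpace) :
    IsSlowWeight fun u => E.tildeNormOn (Ioi u) w := by
  intro ε hε
  obtain ⟨C, hC0, hC⟩ := hw ε hε
  refine ⟨max C 1, by positivity, fun s t hs hst => ?_⟩
  have ht := hs.trans_le hst
  have hle : (C : ℝ≥0∞) ≤ (max C 1 : ℝ≥0) := by exact_mod_cast le_max_left _ _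
  constructor
  · calc E.tildeNormOn (Ioi s) w
        = E.tildeNormOn (Ioi t) fun x => w (s / t * x) := by
          rw [E.tildeNormOn_Ioi_comp_mul (div_pos hs ht), div_mul_cancel₀ _ ht.ne']
      _ ≤ E.tildeNormOn (Ioi t) fun x => (C * ENNReal.ofReal ((t / s) ^ ε)) * w x := by
          refine E.tildeNormOn_mono fun x hx _ => ?_
          have := (hC (s / t * x) x (by positivity)
            (mul_le_of_le_one_left hx.le ((div_le_one ht).2 hst))).1
          rwa [show x / (s / t * x) = t / s by field_simp] at this
      _ ≤ (C * ENNReal.ofReal ((t / s) ^ ε)) * E.tildeNormOn (Ioi t) w :=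
          E.tildeNormOn_const_mul_le
            (Or.inl (ENNReal.mul_ne_top ENNReal.coe_ne_top ENNReal.ofReal_ne_top))
      _ ≤ _ := by gcongr
  · refine (E.tildeNormOn_Ioi_anti w hst).trans (le_mul_of_one_le_left' ?_)
    exact one_le_mul (by exact_mod_cast le_max_right _ _)
      (ENNReal.one_le_ofReal.2 (Real.one_le_rpow ((one_le_div hs).2 hst) hε.le))

theorem IsSlowWeight.tildeNormOn_Ioo {w : ℝ → ℝ≥0∞} (hw : IsSlowWeight w) (E : RISpace) :
    IsSlowWeight fun u => E.tildeNormOn (Ioo 0 u) w := by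
  intro ε hε
  obtain ⟨C, hC0, hC⟩ := hw ε hε
  refine ⟨max C 1, by positivity, fun s t hs hst => ?_⟩
  have ht := hs.trans_le hst
  have hle : (C : ℝ≥0∞) ≤ (max C 1 : ℝ≥0) := by exact_mod_cast le_max_left _ _
  constructor
  · refine (E.tildeNormOn_Ioo_mono w hst).trans (le_mul_of_one_le_left' ?_)
    exact one_le_mul (by exact_mod_cast le_max_right _ _)
      (ENNReal.one_le_ofReal.2 (Real.one_le_rpow ((one_le_div hs).2 hst) hε.le))
  · calc E.tildeNormOn (Ioo 0 t) w
        = E.tildeNormOn (Ioo 0 s) fun x => w (t / s * x) := by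
          rw [E.tildeNormOn_Ioo_comp_mul (div_pos ht hs), div_mul_cancel₀ _ hs.ne']
      _ ≤ E.tildeNormOn (Ioo 0 s) fun x => (C * ENNReal.ofReal ((t / s) ^ ε)) * w x := by
          refine E.tildeNormOn_mono fun x hx _ => ?_
          have := (hC x (t / s * x) hx
            (le_mul_of_one_le_left hx.le ((one_le_div hs).2 hst))).2
          rwa [show t / s * x / x = t / s by field_simp] at this
      _ ≤ (C * ENNReal.ofReal ((t / s) ^ ε)) * E.tildeNormOn (Ioo 0 s) w :=
          E.tildeNormOn_const_mul_le
            (Or.inl (ENNReal.mul_ne_top ENNReal.coe_ne_top ENNReal.ofReal_ne_top))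
      _ ≤ _ := by gcongr

/-! ### Norms of power weights on half-intervals -/

namespace RISpace

variable (E : RISpace)

/-- Self-similarity: s^β equals 2^(-β)(2s)^β, so dilation invariance bounds the norm over
[2^(-n-1),1) by 2^(-β) times the norm over [2^(-n),1), plus a constant. The recursion stays bounded,
and the Fatou property gives the limit. -/
theorem tildeNormOn_Ioo_rpow_lt_top {β : ℝ} (hβ : 0 < β) :
    E.tildeNormOn (Ioo 0 1) (fun s => ENNReal.ofReal (s ^ β)) < ∞ := by
  let p : ℝ → ℝ≥0∞ := fun s => ENNReal.ofReal (s ^ β)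
  have hp : Measurable p := ENNReal.measurable_ofReal.comp (measurable_id.pow_const β)
  let I : ℕ → Set ℝ := fun n => Ico ((1 / 2 : ℝ) ^ n) 1
  have hI : Monotone I := fun m n hmn =>
    Ico_subset_Ico_left (pow_le_pow_of_le_one (by norm_num) (by norm_num) hmn)
  let M := E.tildeNorm ((Ioo (1 / 4 : ℝ) 1).indicator fun _ => 1)
  have hM : M < ∞ := E.tildeNorm_indicator_lt_top measurableSet_Ioo (by
    rw [homHalfLine_Ioo (by norm_num) one_pos]; exact ENNReal.ofReal_lt_top)
  let q : ℝ := (1 / 2 : ℝ) ^ β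
  have hq0 : 0 < q := by positivity
  have hq1 : q < 1 := Real.rpow_lt_one (by norm_num) (by norm_num) hβ
  have hrec : ∀ n, E.tildeNormOn (I (n + 1)) p ≤
      ENNReal.ofReal q * E.tildeNormOn (I n) p + M := by
    intro n
    have h1 : E.tildeNormOn (I (n + 1)) p ≤
        E.tildeNorm fun s => ENNReal.ofReal q * (I n).indicator p (2 * s) +
          (Ioo (1 / 4 : ℝ) 1).indicator (fun _ => 1) s := by
      refine E.tildeNorm_mono fun s hs => ?_
      by_cases hsI : s ∈ I (n + 1)
      · rw [indicator_of_mem hsI]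
        rcases lt_or_ge s (1 / 2) with h | h
        · have h2 : 2 * s ∈ I n := by
            refine ⟨?_, by linarith⟩
            have := hsI.1
            rw [pow_succ] at this
            linarith
          rw [indicator_of_mem h2]
          refine le_add_right (le_of_eq ?_)
          simp only [p]
          rw [← ENNReal.ofReal_mul hq0.le, ← Real.mul_rpow (by norm_num) (by positivity)]
          congr 2
          ring
        · have h2 : s ∈ Ioo (1 / 4 : ℝ) 1 := ⟨by linarith, hsI.2⟩
          rw [indicator_of_mem h2]
          refine le_add_left ?_
          simp only [p]
          rw [ENNReal.ofReal_le_one]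
          exact Real.rpow_le_one hs.le hsI.2.le hβ.le
      · simp [hsI]
    refine h1.trans ((E.tildeNorm_add_le ?_ ?_).trans (add_le_add_left ?_ _))
    · exact (((hp.indicator measurableSet_Ico).comp
        (measurable_const_mul 2)).const_mul _).aemeasurable
    · exact (measurable_const.indicator measurableSet_Ioo).aemeasurable
    · refine (E.tildeNorm_const_mul_le (Or.inl ENNReal.ofReal_ne_top)).trans ?_
      rw [E.tildeNorm_comp_mul two_pos]
      rfl
  -- The fixed point of x ↦ qx + M.
  let L : ℝ≥0∞ := ENNReal.ofReal (M.toReal / (1 - q))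
  have hL : ENNReal.ofReal q * L + M = L := by
    have h1 : 0 < 1 - q := by linarith
    rw [← ENNReal.ofReal_toReal hM.ne, ← ENNReal.ofReal_mul hq0.le,
      ← ENNReal.ofReal_add (by positivity) (by positivity)]
    simp only [L]
    congr 1
    field_simp
    ring
  have hbound : ∀ n, E.tildeNormOn (I n) p ≤ L := by
    intro n
    induction n with
    | zero =>
      have : (I 0).indicator p = fun _ => 0 := by
        funext x
        simp [I]
      unfold tildeNormOn
      rw [this, E.tildeNorm_zero]
      exact zero_le
    | succ n ih => exact (hrec n).trans (le_trans (by gcongr) hL.le)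
  have hsup : E.tildeNormOn (Ioo 0 1) p ≤ E.tildeNorm fun x => ⨆ n, (I n).indicator p x := by
    refine E.tildeNorm_mono fun s hs => ?_
    by_cases hs1 : s < 1
    · obtain ⟨n, hn⟩ := exists_pow_lt_of_lt_one hs (by norm_num : (1 / 2 : ℝ) < 1)
      refine le_iSup_of_le n ?_
      rw [indicator_of_mem (show s ∈ I n from ⟨hn.le, hs1⟩)]
      exact indicator_le_self _ _ _
    · simp [hs1]
  rw [E.tildeNorm_iSup (fun n => (hp.indicator measurableSet_Ico).aemeasurable)
    (fun x m n hmn => indicator_le_indicator_of_subset (hI hmn) (fun _ => zero_le) x)] at hsup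
  exact hsup.trans_lt ((iSup_le hbound).trans_lt ENNReal.ofReal_lt_top)

theorem tildeNormOn_Ioi_rpow {β : ℝ} :
    E.tildeNormOn (Ioi 1) (fun s => ENNReal.ofReal (s ^ (-β))) =
      E.tildeNormOn (Ioo 0 1) (fun s => ENNReal.ofReal (s ^ β)) := by
  unfold tildeNormOn
  rw [← E.tildeNorm_comp_inv]
  refine le_antisymm (E.tildeNorm_mono fun x hx => le_of_eq ?_)
    (E.tildeNorm_mono fun x hx => le_of_eq ?_) <;>
  · have : 1 < x⁻¹ ↔ x < 1 := one_lt_inv₀ hx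
    simp [indicator, this, hx, Real.inv_rpow hx.le, Real.rpow_neg hx.le]

/-- Half of the exponent pays for replacing w(s) by w(u). The other half leaves a power of s/u,
whose norm does not depend on u by dilation invariance. -/
theorem exists_tildeNormOn_rpow_mul_le {w : ℝ → ℝ≥0∞} (hw : IsSlowWeight w)
    (hw' : ∀ u, 0 < u → w u ≠ ⊤) {α : ℝ} (hα : 0 < α) :
    ∃ C : ℝ≥0, ∀ u, 0 < u →
      E.tildeNormOn (Ioo 0 u) (fun s => ENNReal.ofReal (s ^ α) * w s) ≤
        C * (ENNReal.ofReal (u ^ α) * w u) ∧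
      E.tildeNormOn (Ioi u) (fun s => ENNReal.ofReal (s ^ (-α)) * w s) ≤
        C * (ENNReal.ofReal (u ^ (-α)) * w u) := by
  obtain ⟨C, -, hC⟩ := hw (α / 2) (half_pos hα)
  have hfin := E.tildeNormOn_Ioo_rpow_lt_top (half_pos hα)
  lift E.tildeNormOn (Ioo 0 1) (fun s => ENNReal.ofReal (s ^ (α / 2))) to ℝ≥0 using hfin.ne
    with P hP
  have hfinite : ∀ (u x : ℝ), 0 < u → (C : ℝ≥0∞) * (ENNReal.ofReal x * w u) ≠ ⊤ := fun u x hu =>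
    ENNReal.mul_ne_top ENNReal.coe_ne_top (ENNReal.mul_ne_top ENNReal.ofReal_ne_top (hw' u hu))
  refine ⟨C * P, fun u hu => ⟨?_, ?_⟩⟩
  · calc E.tildeNormOn (Ioo 0 u) (fun s => ENNReal.ofReal (s ^ α) * w s)
        ≤ E.tildeNormOn (Ioo 0 u) fun s => (C * (ENNReal.ofReal (u ^ α) * w u)) *
            ENNReal.ofReal ((u⁻¹ * s) ^ (α / 2)) := by
          refine E.tildeNormOn_mono fun s hs hsu => ?_
          calc ENNReal.ofReal (s ^ α) * w s
              ≤ ENNReal.ofReal (s ^ α) * (C * ENNReal.ofReal ((u / s) ^ (α / 2)) * w u) := by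
                gcongr; exact (hC s u hs hsu.2.le).1
            _ = C * (ENNReal.ofReal (s ^ α * (u / s) ^ (α / 2)) * w u) := by
                rw [ENNReal.ofReal_mul (by positivity)]; ring
            _ = C * (ENNReal.ofReal (u ^ α * (u⁻¹ * s) ^ (α / 2)) * w u) := by
                congr 3
                rw [Real.div_rpow hu.le hs.le, Real.mul_rpow (by positivity) hs.le,
                  Real.inv_rpow hu.le, ← add_halves α, Real.rpow_add hs, Real.rpow_add hu,
                  add_halves α]
                field_simp
            _ = _ := by rw [ENNReal.ofReal_mul (by positivity)]; ring
      _ ≤ (C * (ENNReal.ofReal (u ^ α) * w u)) *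
            E.tildeNormOn (Ioo 0 u) fun s => ENNReal.ofReal ((u⁻¹ * s) ^ (α / 2)) :=
          E.tildeNormOn_const_mul_le (Or.inl (hfinite _ _ hu))
      _ = (C * (ENNReal.ofReal (u ^ α) * w u)) * P := by
          rw [E.tildeNormOn_Ioo_comp_mul (inv_pos.2 hu) fun s => ENNReal.ofReal (s ^ (α / 2)),
            inv_mul_cancel₀ hu.ne', hP]
      _ = _ := by push_cast; ring
  · calc E.tildeNormOn (Ioi u) (fun s => ENNReal.ofReal (s ^ (-α)) * w s)
        ≤ E.tildeNormOn (Ioi u) fun s => (C * (ENNReal.ofReal (u ^ (-α)) * w u)) *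
            ENNReal.ofReal ((u⁻¹ * s) ^ (-(α / 2))) := by
          refine E.tildeNormOn_mono fun s hs hsu => ?_
          calc ENNReal.ofReal (s ^ (-α)) * w s
              ≤ ENNReal.ofReal (s ^ (-α)) * (C * ENNReal.ofReal ((s / u) ^ (α / 2)) * w u) := by
                gcongr; exact (hC u s hu (le_of_lt hsu)).2
            _ = C * (ENNReal.ofReal (s ^ (-α) * (s / u) ^ (α / 2)) * w u) := by
                rw [ENNReal.ofReal_mul (by positivity)]; ring
            _ = C * (ENNReal.ofReal (u ^ (-α) * (u⁻¹ * s) ^ (-(α / 2))) * w u) := by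
                congr 3
                rw [Real.div_rpow hs.le hu.le, Real.mul_rpow (by positivity) hs.le,
                  Real.inv_rpow hu.le, Real.rpow_neg hs.le, Real.rpow_neg hu.le,
                  Real.rpow_neg hu.le, Real.rpow_neg hs.le,
                  ← add_halves α, Real.rpow_add hs, Real.rpow_add hu, add_halves α]
                field_simp
            _ = _ := by rw [ENNReal.ofReal_mul (by positivity)]; ring
      _ ≤ (C * (ENNReal.ofReal (u ^ (-α)) * w u)) *
            E.tildeNormOn (Ioi u) fun s => ENNReal.ofReal ((u⁻¹ * s) ^ (-(α / 2))) :=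
          E.tildeNormOn_const_mul_le (Or.inl (hfinite _ _ hu))
      _ = (C * (ENNReal.ofReal (u ^ (-α)) * w u)) * P := by
          rw [E.tildeNormOn_Ioi_comp_mul (inv_pos.2 hu) fun s => ENNReal.ofReal (s ^ (-(α / 2))),
            inv_mul_cancel₀ hu.ne', E.tildeNormOn_Ioi_rpow, hP]
      _ = _ := by push_cast; ring

/-- The intervals (u/2,u) and (u,2u) are dilates of fixed ones, so the norms of their indicators are
positive, finite and independent of u. -/
theorem exists_le_mul_tildeNormOn :
    ∃ D : ℝ≥0, ∀ (w : ℝ → ℝ≥0∞) (m : ℝ≥0∞) (u : ℝ), 0 < u →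
      (∀ s, 0 < s → s ≤ 2 * u → u ≤ 2 * s → m ≤ w s) →
      m ≤ D * E.tildeNormOn (Ioo 0 u) w ∧ m ≤ D * E.tildeNormOn (Ioi u) w := by
  have key : ∀ a b : ℝ, 0 < a → a < b → ∃ D : ℝ≥0, ∀ (w : ℝ → ℝ≥0∞) (m : ℝ≥0∞) (u : ℝ), 0 < u →
      (∀ s, a * u < s → s < b * u → m ≤ w s) →
      m ≤ D * E.tildeNormOn (Ioo (a * u) (b * u)) w := by
    intro a b ha hab
    have hlt : 0 < Real.log b - Real.log a := sub_pos.2 (Real.log_lt_log ha hab)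
    have h0 : E.tildeNormOn (Ioo a b) (fun _ => 1) ≠ 0 :=
      E.tildeNorm_indicator_ne_zero measurableSet_Ioo (by
        rw [homHalfLine_Ioo ha (ha.trans hab)]; simpa using hlt)
    have h1 : E.tildeNormOn (Ioo a b) (fun _ => 1) ≠ ⊤ :=
      (E.tildeNorm_indicator_lt_top measurableSet_Ioo (by
        rw [homHalfLine_Ioo ha (ha.trans hab)]; exact ENNReal.ofReal_lt_top)).ne
    refine ⟨(E.tildeNormOn (Ioo a b) fun _ => 1)⁻¹.toNNReal, fun w m u hu h => ?_⟩
    rw [ENNReal.coe_toNNReal (ENNReal.inv_ne_top.2 h0), mul_comm, ← div_eq_mul_inv,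
      ENNReal.le_div_iff_mul_le (Or.inl h0) (Or.inl h1)]
    have hscale : E.tildeNormOn (Ioo a b) (fun _ => 1) =
        E.tildeNormOn (Ioo (a * u) (b * u)) fun _ => 1 := by
      unfold tildeNormOn
      rw [← E.tildeNorm_comp_mul (inv_pos.2 hu)]
      congr 1
      funext x
      simp [indicator, lt_inv_mul_iff₀ hu, inv_mul_lt_iff₀ hu, mul_comm u]
    rw [hscale]
    refine (E.mul_tildeNormOn_le m _).trans (E.tildeNormOn_mono fun s hs hsI => ?_)
    rw [mul_one]
    exact h s hsI.1 hsI.2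
  obtain ⟨D, hD⟩ := key (1 / 2) 1 (by norm_num) (by norm_num)
  obtain ⟨D', hD'⟩ := key 1 2 (by norm_num) (by norm_num)
  refine ⟨max D D', fun w m u hu h => ⟨?_, ?_⟩⟩
  · refine (hD w m u hu fun s h1 h2 => h s (by linarith) (by linarith) (by linarith)).trans ?_
    refine mul_le_mul' (by exact_mod_cast le_max_left _ _) (E.tildeNormOn_mono_set ?_ w)
    exact Ioo_subset_Ioo (by linarith) (by linarith)
  · refine (hD' w m u hu fun s h1 h2 => h s (by linarith) (by linarith) (by linarith)).trans ?_
    refine mul_le_mul' (by exact_mod_cast le_max_right _ _) (E.tildeNormOn_mono_set ?_ w)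
    intro x hx
    have := hx.1
    rw [one_mul] at this
    exact this

end RISpace

/-! ### Quasi-concave functions and estimates for the two halves of the formula -/

/-- The two properties of `s ↦ K(s, f)`: it is nondecreasing and `K(s, f) / s` is nonincreasing. -/
structure IsQuasiConcave (k : ℝ → ℝ≥0∞) : Prop where
  mono : Monotone k
  le_div_mul : ∀ s t, 0 < s → s ≤ t → k t ≤ ENNReal.ofReal (t / s) * k s

/-- The function `s ↦ s ^ (-θ) * A s * k s`. -/
noncomputable def powerWeight (θ : ℝ) (A k : ℝ → ℝ≥0∞) (s : ℝ) : ℝ≥0∞ :=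
  ENNReal.ofReal (s ^ (-θ)) * A s * k s

/-- The contribution of the `ℒ`-space to the right-hand side of the Holmstedt formula. -/
noncomputable def leftTerm (E F : RISpace) (B g : ℝ → ℝ≥0∞) (u : ℝ) : ℝ≥0∞ :=
  E.tildeNormOn (Ioo 0 u) (fun t => B t * F.tildeNormOn (Ioo 0 t) g) +
    E.tildeNormOn (Ioi u) B * F.tildeNormOn (Ioo 0 u) g

/-- The contribution of the `ℛ`-space to the right-hand side of the Holmstedt formula. -/
noncomputable def rightTerm (E F : RISpace) (B g : ℝ → ℝ≥0∞) (u : ℝ) : ℝ≥0∞ :=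
  E.tildeNormOn (Ioo 0 u) B * F.tildeNormOn (Ioi u) g +
    E.tildeNormOn (Ioi u) (fun t => B t * F.tildeNormOn (Ioi t) g)

section Estimates

variable (E F : RISpace) {A B g g₁ g₂ w : ℝ → ℝ≥0∞} {θ δ : ℝ}

/-- Only the majorants have to be measurable; the point u is negligible for dt/t. -/
theorem RISpace.tildeNorm_le_of_split {f f₁ f₂ : ℝ → ℝ≥0∞} (u : ℝ)
    (hf₁ : AEMeasurable f₁ homHalfLine) (hf₂ : AEMeasurable f₂ homHalfLine)
    (h₁ : ∀ x, 0 < x → x < u → f x ≤ f₁ x) (h₂ : ∀ x, u < x → f x ≤ f₂ x) :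
    E.tildeNorm f ≤ E.tildeNormOn (Ioo 0 u) f₁ + E.tildeNormOn (Ioi u) f₂ := by
  refine le_trans (E.tildeNorm_mono_ae ?_)
    (E.tildeNorm_add_le (hf₁.indicator measurableSet_Ioo) (hf₂.indicator measurableSet_Ioi))
  filter_upwards [ae_homHalfLine_pos_ne u] with x hx
  rcases lt_or_gt_of_ne hx.2 with h | h
  · simpa [indicator, hx.1, h, h.not_gt] using h₁ x hx.1 h
  · simpa [indicator, h, h.not_gt] using h₂ x h

theorem aemeasurable_powerWeight (hA : AEMeasurable A homHalfLine) {k : ℝ → ℝ≥0∞}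
    (hk : Monotone k) : AEMeasurable (powerWeight θ A k) homHalfLine :=
  ((ENNReal.measurable_ofReal.comp (measurable_id.pow_const (-θ))).aemeasurable.mul hA).mul
    hk.measurable.aemeasurable

theorem exists_powerWeight_le (hθ : 0 ≤ θ) (hA : IsSlowWeight A) :
    ∃ D : ℝ≥0, ∀ k, IsQuasiConcave k → ∀ u, 0 < u →
      powerWeight θ A k u ≤ D * F.tildeNormOn (Ioo 0 u) (powerWeight θ A k) ∧
      powerWeight θ A k u ≤ D * F.tildeNormOn (Ioi u) (powerWeight θ A k) := by
  obtain ⟨D, hD⟩ := F.exists_le_mul_tildeNormOn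
  obtain ⟨C, hC⟩ := hA.doubling
  -- For s and u within a factor 2 of each other, the power contributes 2^θ, the weight its doubling
  -- constant C, and k a factor 2.
  let c : ℝ≥0 := (2 ^ θ : ℝ).toNNReal * C * 2
  refine ⟨D * c, fun k hk u hu => ?_⟩
  have h := hD (fun s => c * powerWeight θ A k s) (powerWeight θ A k u) u hu ?_
  · rw [ENNReal.coe_mul, mul_assoc, mul_assoc]
    exact ⟨h.1.trans (by gcongr; exact F.tildeNormOn_const_mul_le (Or.inl ENNReal.coe_ne_top)),
      h.2.trans (by gcongr; exact F.tildeNormOn_const_mul_le (Or.inl ENNReal.coe_ne_top))⟩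
  · intro s hs h1 h2
    have hp : ENNReal.ofReal (u ^ (-θ)) ≤ ENNReal.ofReal (2 ^ θ) * ENNReal.ofReal (s ^ (-θ)) := by
      rw [← ENNReal.ofReal_mul (by positivity)]
      refine ENNReal.ofReal_le_ofReal ?_
      have := Real.rpow_le_rpow_of_nonpos hs h1 (neg_nonpos.2 hθ)
      rw [Real.mul_rpow zero_le_two hu.le, Real.rpow_neg zero_le_two,
        inv_mul_le_iff₀ (by positivity)] at this
      exact this
    have hk2 : k u ≤ 2 * k s := by
      rcases le_total u s with hus | hus
      · exact (hk.mono hus).trans (le_mul_of_one_le_left' one_le_two)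
      · refine (hk.le_div_mul s u hs hus).trans ?_
        gcongr
        exact (ENNReal.ofReal_le_ofReal ((div_le_iff₀ hs).2 h2)).trans (by simp)
    calc powerWeight θ A k u ≤ (ENNReal.ofReal (2 ^ θ) * ENNReal.ofReal (s ^ (-θ))) *
          (C * A s) * (2 * k s) := by
            unfold powerWeight
            gcongr
            exact hC s u hs hu h1 h2
      _ = _ := by
            simp only [c, powerWeight, ENNReal.ofReal]
            push_cast
            ring

theorem isQuasiConcave_one : IsQuasiConcave fun _ => 1 :=
  ⟨monotone_const, fun s t hs hst => by
    simpa using ENNReal.one_le_ofReal.2 ((one_le_div hs).2 hst)⟩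

theorem IsSlowWeight.exists_le_tildeNormOn (hA : IsSlowWeight A) :
    ∃ D : ℝ≥0, ∀ u, 0 < u → A u ≤ D * F.tildeNormOn (Ioo 0 u) A ∧
      A u ≤ D * F.tildeNormOn (Ioi u) A := by
  obtain ⟨D, hD⟩ := exists_powerWeight_le F le_rfl hA
  have : powerWeight 0 A (fun _ => 1) = A := by
    funext s
    simp [powerWeight]
  exact ⟨D, fun u hu => by simpa only [this] using hD _ isQuasiConcave_one u hu⟩

/-- Here k' stands for K(·,g), with g the part of f in X₀. Beyond u it is at most a constant
multiple of k(u), and s^(-θ)A(s) has norm over (u,∞) comparable to its value at u, so the whole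
inner norm is controlled by its part on (0,u). -/
theorem exists_left_upper (hθ : 0 < θ) (hA : IsSlowWeight A) (hAm : AEMeasurable A homHalfLine)
    (hA' : ∀ u, 0 < u → A u ≠ ⊤) (hBm : AEMeasurable B homHalfLine)
    (hB : ∀ u, 0 < u → E.tildeNormOn (Ioi u) B ≠ 0) :
    ∃ C : ℝ≥0, ∀ (k k' : ℝ → ℝ≥0∞) (D : ℝ≥0) (u : ℝ), 0 < u → IsQuasiConcave k → k u ≠ ⊤ →
      (∀ s, 0 < s → s ≤ u → k' s ≤ D * k s) → (∀ s, u ≤ s → k' s ≤ D * k u) →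
      E.tildeNorm (fun t => B t * F.tildeNormOn (Ioo 0 t) (powerWeight θ A k')) ≤
        C * D * leftTerm E F B (powerWeight θ A k) u := by
  obtain ⟨C₁, hC₁⟩ := F.exists_tildeNormOn_rpow_mul_le hA hA' hθ
  obtain ⟨D₁, hD₁⟩ := exists_powerWeight_le F hθ.le hA
  refine ⟨1 + C₁ * D₁, fun k k' D u hu hk hku h₁ h₂ => ?_⟩
  let M := F.tildeNormOn (Ioo 0 u) (powerWeight θ A k)
  have hkm := aemeasurable_powerWeight (θ := θ) hAm hk.mono
  have hDk : (D : ℝ≥0∞) * k u ≠ ⊤ := ENNReal.mul_ne_top ENNReal.coe_ne_top hku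
  have hsmall : ∀ t, t < u → F.tildeNormOn (Ioo 0 t) (powerWeight θ A k') ≤
      D * F.tildeNormOn (Ioo 0 t) (powerWeight θ A k) := by
    intro t ht
    refine le_trans (F.tildeNormOn_mono fun s hs hst => ?_)
      (F.tildeNormOn_const_mul_le (c := D) (Or.inl ENNReal.coe_ne_top))
    calc powerWeight θ A k' s ≤ ENNReal.ofReal (s ^ (-θ)) * A s * (D * k s) := by
          unfold powerWeight; gcongr; exact h₁ s hs (hst.2.trans ht).le
      _ = _ := by unfold powerWeight; ring
  have hlarge : ∀ t, F.tildeNormOn (Ioo 0 t) (powerWeight θ A k') ≤ D * (1 + C₁ * D₁) * M := by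
    intro t
    calc F.tildeNormOn (Ioo 0 t) (powerWeight θ A k')
        ≤ F.tildeNorm (powerWeight θ A k') := F.tildeNormOn_le_tildeNorm _ _
      _ ≤ F.tildeNormOn (Ioo 0 u) (fun s => D * powerWeight θ A k s) +
          F.tildeNormOn (Ioi u) (fun s => (D * k u) * (ENNReal.ofReal (s ^ (-θ)) * A s)) := by
        refine F.tildeNorm_le_of_split u (hkm.const_mul _) (AEMeasurable.const_mul
          ((ENNReal.measurable_ofReal.comp (measurable_id.pow_const (-θ))).aemeasurable.mul hAm)
            _) (fun s hs hsu => ?_) (fun s hsu => ?_)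
        · calc powerWeight θ A k' s ≤ ENNReal.ofReal (s ^ (-θ)) * A s * (D * k s) := by
                unfold powerWeight; gcongr; exact h₁ s hs hsu.le
            _ = _ := by unfold powerWeight; ring
        · calc powerWeight θ A k' s ≤ ENNReal.ofReal (s ^ (-θ)) * A s * (D * k u) := by
                unfold powerWeight; gcongr; exact h₂ s hsu.le
            _ = _ := mul_comm _ _
      _ ≤ D * M + (D * k u) * (C₁ * (ENNReal.ofReal (u ^ (-θ)) * A u)) :=
        add_le_add (F.tildeNormOn_const_mul_le (Or.inl ENNReal.coe_ne_top))
          ((F.tildeNormOn_const_mul_le (Or.inl hDk)).trans (by gcongr; exact (hC₁ u hu).2))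
      _ = D * M + D * C₁ * powerWeight θ A k u := by unfold powerWeight; ring
      -- The value at u is absorbed into the norm over (0,u).
      _ ≤ D * M + D * C₁ * (D₁ * M) := by gcongr; exact (hD₁ k hk u hu).1
      _ = _ := by ring
  calc E.tildeNorm (fun t => B t * F.tildeNormOn (Ioo 0 t) (powerWeight θ A k'))
      ≤ E.tildeNormOn (Ioo 0 u)
            (fun t => D * (B t * F.tildeNormOn (Ioo 0 t) (powerWeight θ A k))) +
          E.tildeNormOn (Ioi u) (fun t => (D * (1 + C₁ * D₁) * M) * B t) := by
        refine E.tildeNorm_le_of_split u (AEMeasurable.const_mul (hBm.mul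
          (F.tildeNormOn_Ioo_mono _).measurable.aemeasurable) _) (hBm.const_mul _)
          (fun t ht htu => ?_) (fun t htu => ?_)
        · rw [mul_left_comm]
          gcongr
          exact hsmall t htu
        · rw [mul_comm]
          gcongr
          exact hlarge t
    _ ≤ D * E.tildeNormOn (Ioo 0 u)
            (fun t => B t * F.tildeNormOn (Ioo 0 t) (powerWeight θ A k)) +
          (D * (1 + C₁ * D₁) * M) * E.tildeNormOn (Ioi u) B :=
        add_le_add (E.tildeNormOn_const_mul_le (Or.inl ENNReal.coe_ne_top))
          -- The factor M may be infinite here, so homogeneity is justified by the nonzero tail norm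
          -- of B.
          (E.tildeNormOn_const_mul_le (Or.inr (hB u hu)))
    _ ≤ (1 + C₁ * D₁) * (D * E.tildeNormOn (Ioo 0 u)
            (fun t => B t * F.tildeNormOn (Ioo 0 t) (powerWeight θ A k))) +
          (D * (1 + C₁ * D₁) * M) * E.tildeNormOn (Ioi u) B := by
        exact add_le_add (le_mul_of_one_le_left' (le_add_right le_rfl)) le_rfl
    _ = _ := by
        unfold leftTerm
        push_cast
        ring

/-- Mirror image of `exists_left_upper` for the part of f in X₁. Below u the bound by (s/u)k(u)
turns s^(-θ) into s^(1-θ), a positive power because θ < 1. -/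
theorem exists_right_upper (hθ₀ : 0 < θ) (hθ : θ < 1) (hA : IsSlowWeight A)
    (hAm : AEMeasurable A homHalfLine)
    (hA' : ∀ u, 0 < u → A u ≠ ⊤) (hBm : AEMeasurable B homHalfLine)
    (hB : ∀ u, 0 < u → E.tildeNormOn (Ioo 0 u) B ≠ 0) :
    ∃ C : ℝ≥0, ∀ (k k' : ℝ → ℝ≥0∞) (D : ℝ≥0) (u : ℝ), 0 < u → IsQuasiConcave k → k u ≠ ⊤ →
      (∀ s, 0 < s → s ≤ u → k' s ≤ D * (ENNReal.ofReal (s / u) * k u)) →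
      (∀ s, u ≤ s → k' s ≤ D * k s) →
      E.tildeNorm (fun t => B t * F.tildeNormOn (Ioi t) (powerWeight θ A k')) ≤
        C * D * rightTerm E F B (powerWeight θ A k) u := by
  obtain ⟨C₁, hC₁⟩ := F.exists_tildeNormOn_rpow_mul_le hA hA' (sub_pos.2 hθ)
  obtain ⟨D₁, hD₁⟩ := exists_powerWeight_le F hθ₀.le hA
  refine ⟨1 + C₁ * D₁, fun k k' D u hu hk hku h₁ h₂ => ?_⟩
  let M := F.tildeNormOn (Ioi u) (powerWeight θ A k)
  have hkm := aemeasurable_powerWeight (θ := θ) hAm hk.mono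
  have hDk : (D : ℝ≥0∞) * (ENNReal.ofReal u⁻¹ * k u) ≠ ⊤ :=
    ENNReal.mul_ne_top ENNReal.coe_ne_top (ENNReal.mul_ne_top ENNReal.ofReal_ne_top hku)
  have hlarge : ∀ t, u < t → F.tildeNormOn (Ioi t) (powerWeight θ A k') ≤
      D * F.tildeNormOn (Ioi t) (powerWeight θ A k) := by
    intro t ht
    refine le_trans (F.tildeNormOn_mono fun s hs hst => ?_)
      (F.tildeNormOn_const_mul_le (c := D) (Or.inl ENNReal.coe_ne_top))
    calc powerWeight θ A k' s ≤ ENNReal.ofReal (s ^ (-θ)) * A s * (D * k s) := by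
          unfold powerWeight; gcongr; exact h₂ s (ht.trans hst).le
      _ = _ := by unfold powerWeight; ring
  have hsmall : ∀ t, F.tildeNormOn (Ioi t) (powerWeight θ A k') ≤ D * (1 + C₁ * D₁) * M := by
    intro t
    calc F.tildeNormOn (Ioi t) (powerWeight θ A k')
        ≤ F.tildeNorm (powerWeight θ A k') := F.tildeNormOn_le_tildeNorm _ _
      _ ≤ F.tildeNormOn (Ioo 0 u) (fun s => (D * (ENNReal.ofReal u⁻¹ * k u)) *
            (ENNReal.ofReal (s ^ (1 - θ)) * A s)) +
          F.tildeNormOn (Ioi u) (fun s => D * powerWeight θ A k s) := by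
        refine F.tildeNorm_le_of_split u (AEMeasurable.const_mul
          ((ENNReal.measurable_ofReal.comp (measurable_id.pow_const (1 - θ))).aemeasurable.mul
            hAm) _) (hkm.const_mul _) (fun s hs hsu => ?_) (fun s hsu => ?_)
        · calc powerWeight θ A k' s
                ≤ ENNReal.ofReal (s ^ (-θ)) * A s * (D * (ENNReal.ofReal (s / u) * k u)) := by
                unfold powerWeight; gcongr; exact h₁ s hs hsu.le
            _ = _ := by
                rw [sub_eq_add_neg, Real.rpow_add hs, Real.rpow_one, div_eq_mul_inv,
                  ENNReal.ofReal_mul hs.le, ENNReal.ofReal_mul hs.le]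
                ring
        · calc powerWeight θ A k' s ≤ ENNReal.ofReal (s ^ (-θ)) * A s * (D * k s) := by
                unfold powerWeight; gcongr; exact h₂ s hsu.le
            _ = _ := by unfold powerWeight; ring
      _ ≤ (D * (ENNReal.ofReal u⁻¹ * k u)) * (C₁ * (ENNReal.ofReal (u ^ (1 - θ)) * A u)) +
          D * M :=
        add_le_add ((F.tildeNormOn_const_mul_le (Or.inl hDk)).trans
          (by gcongr; exact (hC₁ u hu).1))
          (F.tildeNormOn_const_mul_le (Or.inl ENNReal.coe_ne_top))
      _ = D * C₁ * powerWeight θ A k u + D * M := by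
        have hone : ENNReal.ofReal u⁻¹ * ENNReal.ofReal (u ^ (1 - θ)) =
            ENNReal.ofReal (u ^ (-θ)) := by
          rw [← ENNReal.ofReal_mul (by positivity), sub_eq_add_neg, Real.rpow_add hu,
            Real.rpow_one, inv_mul_cancel_left₀ hu.ne']
        unfold powerWeight
        rw [← hone]
        ring
      _ ≤ D * C₁ * (D₁ * M) + D * M := by gcongr; exact (hD₁ k hk u hu).2
      _ = _ := by ring
  calc E.tildeNorm (fun t => B t * F.tildeNormOn (Ioi t) (powerWeight θ A k'))
      ≤ E.tildeNormOn (Ioo 0 u) (fun t => (D * (1 + C₁ * D₁) * M) * B t) +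
          E.tildeNormOn (Ioi u)
            (fun t => D * (B t * F.tildeNormOn (Ioi t) (powerWeight θ A k))) := by
        refine E.tildeNorm_le_of_split u (hBm.const_mul _) (AEMeasurable.const_mul (hBm.mul
          (F.tildeNormOn_Ioi_anti _).measurable.aemeasurable) _)
          (fun t ht htu => ?_) (fun t htu => ?_)
        · rw [mul_comm]
          gcongr
          exact hsmall t
        · rw [mul_left_comm]
          gcongr
          exact hlarge t htu
    _ ≤ (D * (1 + C₁ * D₁) * M) * E.tildeNormOn (Ioo 0 u) B + D * E.tildeNormOn (Ioi u)
            (fun t => B t * F.tildeNormOn (Ioi t) (powerWeight θ A k)) :=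
        add_le_add (E.tildeNormOn_const_mul_le (Or.inr (hB u hu)))
          (E.tildeNormOn_const_mul_le (Or.inl ENNReal.coe_ne_top))
    _ ≤ (D * (1 + C₁ * D₁) * M) * E.tildeNormOn (Ioo 0 u) B +
          (1 + C₁ * D₁) * (D * E.tildeNormOn (Ioi u)
            (fun t => B t * F.tildeNormOn (Ioi t) (powerWeight θ A k))) := by
        exact add_le_add le_rfl (le_mul_of_one_le_left' (le_add_right le_rfl))
    _ = _ := by
        unfold rightTerm
        push_cast
        ring

theorem leftTerm_le_add (c : ℝ≥0) (u : ℝ) (hB : AEMeasurable B homHalfLine)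
    (h₁ : AEMeasurable g₁ homHalfLine) (h₂ : AEMeasurable g₂ homHalfLine)
    (h : ∀ s, 0 < s → g s ≤ c * (g₁ s + g₂ s)) :
    leftTerm E F B g u ≤ c * (leftTerm E F B g₁ u + leftTerm E F B g₂ u) := by
  have hF : ∀ t, F.tildeNormOn (Ioo 0 t) g ≤
      c * (F.tildeNormOn (Ioo 0 t) g₁ + F.tildeNormOn (Ioo 0 t) g₂) := by
    intro t
    refine (F.tildeNormOn_mono fun s hs _ => h s hs).trans
      ((F.tildeNormOn_const_mul_le (Or.inl ENNReal.coe_ne_top)).trans ?_)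
    gcongr
    exact F.tildeNormOn_add_le measurableSet_Ioo h₁ h₂
  have hE : E.tildeNormOn (Ioo 0 u) (fun t => B t * F.tildeNormOn (Ioo 0 t) g) ≤
      c * (E.tildeNormOn (Ioo 0 u) (fun t => B t * F.tildeNormOn (Ioo 0 t) g₁) +
        E.tildeNormOn (Ioo 0 u) (fun t => B t * F.tildeNormOn (Ioo 0 t) g₂)) := by
    refine le_trans (E.tildeNormOn_mono (g := fun t => c * (B t * F.tildeNormOn (Ioo 0 t) g₁ +
      B t * F.tildeNormOn (Ioo 0 t) g₂)) fun t _ _ => ?_)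
      ((E.tildeNormOn_const_mul_le (Or.inl ENNReal.coe_ne_top)).trans ?_)
    · rw [← mul_add, mul_left_comm]
      gcongr
      exact hF t
    · gcongr
      exact E.tildeNormOn_add_le measurableSet_Ioo
        (hB.mul (F.tildeNormOn_Ioo_mono _).measurable.aemeasurable)
        (hB.mul (F.tildeNormOn_Ioo_mono _).measurable.aemeasurable)
  refine (add_le_add hE (mul_le_mul_right (hF u) _)).trans (le_of_eq ?_)
  unfold leftTerm
  ring

theorem rightTerm_le_add (c : ℝ≥0) (u : ℝ) (hB : AEMeasurable B homHalfLine)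
    (h₁ : AEMeasurable g₁ homHalfLine) (h₂ : AEMeasurable g₂ homHalfLine)
    (h : ∀ s, 0 < s → g s ≤ c * (g₁ s + g₂ s)) :
    rightTerm E F B g u ≤ c * (rightTerm E F B g₁ u + rightTerm E F B g₂ u) := by
  have hF : ∀ t, F.tildeNormOn (Ioi t) g ≤
      c * (F.tildeNormOn (Ioi t) g₁ + F.tildeNormOn (Ioi t) g₂) := by
    intro t
    refine (F.tildeNormOn_mono fun s hs _ => h s hs).trans
      ((F.tildeNormOn_const_mul_le (Or.inl ENNReal.coe_ne_top)).trans ?_)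
    gcongr
    exact F.tildeNormOn_add_le measurableSet_Ioi h₁ h₂
  have hE : E.tildeNormOn (Ioi u) (fun t => B t * F.tildeNormOn (Ioi t) g) ≤
      c * (E.tildeNormOn (Ioi u) (fun t => B t * F.tildeNormOn (Ioi t) g₁) +
        E.tildeNormOn (Ioi u) (fun t => B t * F.tildeNormOn (Ioi t) g₂)) := by
    refine le_trans (E.tildeNormOn_mono (g := fun t => c * (B t * F.tildeNormOn (Ioi t) g₁ +
      B t * F.tildeNormOn (Ioi t) g₂)) fun t _ _ => ?_)
      ((E.tildeNormOn_const_mul_le (Or.inl ENNReal.coe_ne_top)).trans ?_)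
    · rw [← mul_add, mul_left_comm]
      gcongr
      exact hF t
    · gcongr
      exact E.tildeNormOn_add_le measurableSet_Ioi
        (hB.mul (F.tildeNormOn_Ioi_anti _).measurable.aemeasurable)
        (hB.mul (F.tildeNormOn_Ioi_anti _).measurable.aemeasurable)
  refine (add_le_add (mul_le_mul_right (hF u) _) hE).trans (le_of_eq ?_)
  unfold rightTerm
  ring

/-- For t > u the inner norm over (0,t) dominates the one over (0,u), which then factors out as a
constant. -/
theorem tildeNormOn_Ioi_mul_le (u : ℝ) (B g : ℝ → ℝ≥0∞) :
    E.tildeNormOn (Ioi u) B * F.tildeNormOn (Ioo 0 u) g ≤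
      E.tildeNorm fun t => B t * F.tildeNormOn (Ioo 0 t) g := by
  rw [mul_comm]
  refine (E.mul_tildeNormOn_le _ _).trans
    ((E.tildeNormOn_mono fun t _ htu => ?_).trans (E.tildeNormOn_le_tildeNorm (Ioi u) _))
  rw [mul_comm]
  gcongr
  exact F.tildeNormOn_Ioo_mono g (le_of_lt htu)

theorem tildeNormOn_Ioo_mul_le (u : ℝ) (B g : ℝ → ℝ≥0∞) :
    E.tildeNormOn (Ioo 0 u) B * F.tildeNormOn (Ioi u) g ≤
      E.tildeNorm fun t => B t * F.tildeNormOn (Ioi t) g := by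
  rw [mul_comm]
  refine (E.mul_tildeNormOn_le _ _).trans
    ((E.tildeNormOn_mono fun t _ htu => ?_).trans (E.tildeNormOn_le_tildeNorm (Ioo 0 u) _))
  rw [mul_comm]
  gcongr
  exact F.tildeNormOn_Ioi_anti g htu.2.le

theorem leftTerm_le (u : ℝ) (B g : ℝ → ℝ≥0∞) :
    leftTerm E F B g u ≤ 2 * E.tildeNorm fun t => B t * F.tildeNormOn (Ioo 0 t) g := by
  rw [two_mul]
  exact add_le_add (E.tildeNormOn_le_tildeNorm _ _) (tildeNormOn_Ioi_mul_le E F u B g)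

theorem rightTerm_le (u : ℝ) (B g : ℝ → ℝ≥0∞) :
    rightTerm E F B g u ≤ 2 * E.tildeNorm fun t => B t * F.tildeNormOn (Ioi t) g := by
  rw [two_mul]
  exact add_le_add (tildeNormOn_Ioo_mul_le E F u B g) (E.tildeNormOn_le_tildeNorm _ _)

/-- Cross-term estimate. The power-weight bound is applied twice, to the inner F-norm and then to
the outer E-norm; the resulting B(u) is dominated by the norm of B over (u,∞), so both summands of
`leftTerm` take the same form. -/
theorem exists_leftTerm_le_of_le (hδ : 0 < δ) (hw : IsSlowWeight w)
    (hw' : ∀ u, 0 < u → w u ≠ ⊤) (hB : IsSlowWeight B) (hB' : ∀ u, 0 < u → B u ≠ ⊤) :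
    ∃ C : ℝ≥0, ∀ (g : ℝ → ℝ≥0∞) (y : ℝ≥0∞) (u : ℝ), y ≠ ⊤ → 0 < u →
      (∀ s, 0 < s → g s ≤ y * (ENNReal.ofReal (s ^ δ) * w s)) →
      leftTerm E F B g u ≤
        C * (y * (ENNReal.ofReal (u ^ δ) * w u * E.tildeNormOn (Ioi u) B)) := by
  obtain ⟨C₁, hC₁⟩ := F.exists_tildeNormOn_rpow_mul_le hw hw' hδ
  obtain ⟨C₂, hC₂⟩ := E.exists_tildeNormOn_rpow_mul_le (hB.mul hw)
    (fun u hu => ENNReal.mul_ne_top (hB' u hu) (hw' u hu)) hδ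
  obtain ⟨D, hD⟩ := hB.exists_le_tildeNormOn E
  refine ⟨C₁ * C₂ * D + C₁, fun g y u hy hu hg => ?_⟩
  have hF : ∀ t, 0 < t → F.tildeNormOn (Ioo 0 t) g ≤
      y * (C₁ * (ENNReal.ofReal (t ^ δ) * w t)) := fun t ht =>
    (F.tildeNormOn_mono fun s hs _ => hg s hs).trans
      ((F.tildeNormOn_const_mul_le (Or.inl hy)).trans (by gcongr; exact (hC₁ t ht).1))
  have hE : E.tildeNormOn (Ioo 0 u) (fun t => B t * F.tildeNormOn (Ioo 0 t) g) ≤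
      (y * C₁) * (C₂ * (ENNReal.ofReal (u ^ δ) * (D * E.tildeNormOn (Ioi u) B * w u))) := by
    refine le_trans (E.tildeNormOn_mono
      (g := fun t => (y * C₁) * (ENNReal.ofReal (t ^ δ) * (B t * w t))) fun t ht _ => ?_)
      ((E.tildeNormOn_const_mul_le (Or.inl (ENNReal.mul_ne_top hy ENNReal.coe_ne_top))).trans ?_)
    · exact (mul_le_mul_right (hF t ht) (B t)).trans (le_of_eq (by ring))
    · gcongr
      refine (hC₂ u hu).1.trans ?_
      gcongr
      exact (hD u hu).2
  refine (add_le_add hE (mul_le_mul_right (hF u hu) _)).trans (le_of_eq ?_)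
  push_cast
  ring

theorem exists_rightTerm_le_of_le (hδ : 0 < δ) (hw : IsSlowWeight w)
    (hw' : ∀ u, 0 < u → w u ≠ ⊤) (hB : IsSlowWeight B) (hB' : ∀ u, 0 < u → B u ≠ ⊤) :
    ∃ C : ℝ≥0, ∀ (g : ℝ → ℝ≥0∞) (y : ℝ≥0∞) (u : ℝ), y ≠ ⊤ → 0 < u →
      (∀ s, 0 < s → g s ≤ y * (ENNReal.ofReal (s ^ (-δ)) * w s)) →
      rightTerm E F B g u ≤
        C * (y * (ENNReal.ofReal (u ^ (-δ)) * w u * E.tildeNormOn (Ioo 0 u) B)) := by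
  obtain ⟨C₁, hC₁⟩ := F.exists_tildeNormOn_rpow_mul_le hw hw' hδ
  obtain ⟨C₂, hC₂⟩ := E.exists_tildeNormOn_rpow_mul_le (hB.mul hw)
    (fun u hu => ENNReal.mul_ne_top (hB' u hu) (hw' u hu)) hδ
  obtain ⟨D, hD⟩ := hB.exists_le_tildeNormOn E
  refine ⟨C₁ * C₂ * D + C₁, fun g y u hy hu hg => ?_⟩
  have hF : ∀ t, 0 < t → F.tildeNormOn (Ioi t) g ≤
      y * (C₁ * (ENNReal.ofReal (t ^ (-δ)) * w t)) := fun t ht =>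
    (F.tildeNormOn_mono fun s hs _ => hg s hs).trans
      ((F.tildeNormOn_const_mul_le (Or.inl hy)).trans (by gcongr; exact (hC₁ t ht).2))
  have hE : E.tildeNormOn (Ioi u) (fun t => B t * F.tildeNormOn (Ioi t) g) ≤
      (y * C₁) * (C₂ * (ENNReal.ofReal (u ^ (-δ)) * (D * E.tildeNormOn (Ioo 0 u) B * w u))) := by
    refine le_trans (E.tildeNormOn_mono
      (g := fun t => (y * C₁) * (ENNReal.ofReal (t ^ (-δ)) * (B t * w t))) fun t ht _ => ?_)
      ((E.tildeNormOn_const_mul_le (Or.inl (ENNReal.mul_ne_top hy ENNReal.coe_ne_top))).trans ?_)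
    · exact (mul_le_mul_right (hF t ht) (B t)).trans (le_of_eq (by ring))
    · gcongr
      refine (hC₂ u hu).2.trans ?_
      gcongr
      exact (hD u hu).1
  refine (add_le_add (mul_le_mul_right (hF u hu) _) hE).trans (le_of_eq ?_)
  push_cast
  ring

/-- Transfers a pointwise bound on k from one exponent and weight to another. In the application, b
is T₀(s) or T₁(s) and y a multiple of the norm in Y₀ or Y₁. -/
theorem powerWeight_le_of_mul_le {A' k : ℝ → ℝ≥0∞} {θ' s : ℝ} {b y : ℝ≥0∞} (hs : 0 < s)
    (h0 : A s * b ≠ 0) (h1 : A s * b ≠ ⊤) (h : powerWeight θ A k s * b ≤ y) :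
    powerWeight θ' A' k s ≤ y * (ENNReal.ofReal (s ^ (θ - θ')) * (A' s * (A s * b)⁻¹)) := by
  have hx : ENNReal.ofReal (s ^ (-θ)) * k s ≤ y * (A s * b)⁻¹ := by
    rw [← div_eq_mul_inv, ENNReal.le_div_iff_mul_le (Or.inl h0) (Or.inl h1)]
    refine le_trans (le_of_eq ?_) h
    unfold powerWeight
    ring
  calc powerWeight θ' A' k s
      = ENNReal.ofReal (s ^ (θ - θ')) * A' s * (ENNReal.ofReal (s ^ (-θ)) * k s) := by
        unfold powerWeight
        rw [show -θ' = (θ - θ') + -θ by ring, Real.rpow_add hs, ENNReal.ofReal_mul (by positivity)]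
        ring
    _ ≤ ENNReal.ofReal (s ^ (θ - θ')) * A' s * (y * (A s * b)⁻¹) := by gcongr
    _ = _ := by ring

end Estimates

/-! ### The Peetre K-functional -/

section PeetreFunctional

variable {V : Type*} [AddCommGroup V] {N₀ N₁ : V → ℝ≥0∞} {t : ℝ≥0∞}

theorem peetreK_le {f f₀ f₁ : V} (h₀ : N₀ f₀ < ∞) (h₁ : N₁ f₁ < ∞) (h : f = f₀ + f₁) :
    peetreK N₀ N₁ t f ≤ N₀ f₀ + t * N₁ f₁ :=
  iInf_le_of_le f₀ (iInf_le_of_le f₁ (iInf_le_of_le ⟨h₀, h₁, h⟩ le_rfl))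

theorem le_peetreK {f : V} {c : ℝ≥0∞}
    (h : ∀ f₀ f₁, N₀ f₀ < ∞ → N₁ f₁ < ∞ → f = f₀ + f₁ → c ≤ N₀ f₀ + t * N₁ f₁) :
    c ≤ peetreK N₀ N₁ t f :=
  le_iInf fun f₀ => le_iInf fun f₁ => le_iInf fun hf => h f₀ f₁ hf.1 hf.2.1 hf.2.2

theorem exists_of_peetreK_lt {f : V} {c : ℝ≥0∞} (h : peetreK N₀ N₁ t f < c) :
    ∃ f₀ f₁, N₀ f₀ < ∞ ∧ N₁ f₁ < ∞ ∧ f = f₀ + f₁ ∧ N₀ f₀ + t * N₁ f₁ < c := by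
  simp only [peetreK, iInf_lt_iff] at h
  obtain ⟨f₀, f₁, ⟨h₀, h₁, hf⟩, hlt⟩ := h
  exact ⟨f₀, f₁, h₀, h₁, hf, hlt⟩

theorem isQuasiConcave_peetreK (N₀ N₁ : V → ℝ≥0∞) (f : V) :
    IsQuasiConcave fun s => peetreK N₀ N₁ (ENNReal.ofReal s) f where
  mono s t hst := le_peetreK fun f₀ f₁ h₀ h₁ hf => (peetreK_le h₀ h₁ hf).trans (by gcongr)
  le_div_mul s t hs hst := by
    have hpos : 0 < t / s := div_pos (hs.trans_le hst) hs
    rw [← ENNReal.inv_mul_le_iff (by simpa using hpos) ENNReal.ofReal_ne_top]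
    refine le_peetreK fun f₀ f₁ h₀ h₁ hf => ?_
    rw [ENNReal.inv_mul_le_iff (by simpa using hpos) ENNReal.ofReal_ne_top]
    refine (peetreK_le h₀ h₁ hf).trans ?_
    rw [mul_add, ← mul_assoc, ← ENNReal.ofReal_mul hpos.le, div_mul_cancel₀ _ hs.ne']
    gcongr
    exact le_mul_of_one_le_left' (ENNReal.one_le_ofReal.2 ((one_le_div hs).2 hst))

theorem peetreK_add_le {c : ℝ≥0} (hc : c ≠ 0) (h₀ : ∀ x y, N₀ (x + y) ≤ c * (N₀ x + N₀ y))
    (h₁ : ∀ x y, N₁ (x + y) ≤ c * (N₁ x + N₁ y)) (f g : V) :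
    peetreK N₀ N₁ t (f + g) ≤ c * (peetreK N₀ N₁ t f + peetreK N₀ N₁ t g) := by
  have hlt : ∀ x y : ℝ≥0∞, x < ∞ → y < ∞ → (c : ℝ≥0∞) * (x + y) < ∞ := fun x y hx hy =>
    ENNReal.mul_lt_top ENNReal.coe_lt_top (ENNReal.add_lt_top.2 ⟨hx, hy⟩)
  have key : ∀ f₀ f₁ g₀ g₁, N₀ f₀ < ∞ → N₁ f₁ < ∞ → f = f₀ + f₁ → N₀ g₀ < ∞ → N₁ g₁ < ∞ →
      g = g₀ + g₁ → peetreK N₀ N₁ t (f + g) ≤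
        c * ((N₀ f₀ + t * N₁ f₁) + (N₀ g₀ + t * N₁ g₁)) := by
    intro f₀ f₁ g₀ g₁ hf₀ hf₁ hf hg₀ hg₁ hg
    refine (peetreK_le ((h₀ f₀ g₀).trans_lt (hlt _ _ hf₀ hg₀))
      ((h₁ f₁ g₁).trans_lt (hlt _ _ hf₁ hg₁))
      (by rw [hf, hg, add_add_add_comm])).trans ?_
    calc N₀ (f₀ + g₀) + t * N₁ (f₁ + g₁)
        ≤ c * (N₀ f₀ + N₀ g₀) + t * (c * (N₁ f₁ + N₁ g₁)) := by
          gcongr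
          · exact h₀ _ _
          · exact h₁ _ _
      _ = _ := by ring
  have hc0 : (c : ℝ≥0∞) ≠ 0 := by exact_mod_cast hc
  simp only [peetreK, ENNReal.iInf_add, ENNReal.add_iInf,
    ENNReal.mul_iInf_of_ne hc0 ENNReal.coe_ne_top]
  refine le_iInf fun f₀ => le_iInf fun f₁ => le_iInf fun hf => le_iInf fun g₀ =>
    le_iInf fun g₁ => le_iInf fun hg => ?_
  exact key g₀ g₁ f₀ f₁ hg.1 hg.2.1 hg.2.2 hf.1 hf.2.1 hf.2.2

theorem peetreK_lt_top {f : V} (hf : f ∈ sumSpace N₀ N₁) (ht : t ≠ ⊤) :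
    peetreK N₀ N₁ t f < ∞ := by
  obtain ⟨f₀, f₁, h₀, h₁, hf⟩ := hf
  exact (peetreK_le h₀ h₁ hf).trans_lt
    (ENNReal.add_lt_top.2 ⟨h₀, ENNReal.mul_lt_top ht.lt_top h₁⟩)

theorem add_mem_sumSpace {c : ℝ≥0} (h₀ : ∀ x y, N₀ (x + y) ≤ c * (N₀ x + N₀ y))
    (h₁ : ∀ x y, N₁ (x + y) ≤ c * (N₁ x + N₁ y)) {f g : V} (hf : f ∈ sumSpace N₀ N₁)
    (hg : g ∈ sumSpace N₀ N₁) : f + g ∈ sumSpace N₀ N₁ := by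
  obtain ⟨f₀, f₁, hf₀, hf₁, rfl⟩ := hf
  obtain ⟨g₀, g₁, hg₀, hg₁, rfl⟩ := hg
  exact ⟨f₀ + g₀, f₁ + g₁,
    (h₀ _ _).trans_lt (ENNReal.mul_lt_top ENNReal.coe_lt_top (ENNReal.add_lt_top.2 ⟨hf₀, hg₀⟩)),
    (h₁ _ _).trans_lt (ENNReal.mul_lt_top ENNReal.coe_lt_top (ENNReal.add_lt_top.2 ⟨hf₁, hg₁⟩)),
    add_add_add_comm _ _ _ _⟩

theorem normL_eq {θ : ℝ} {a b : ℝ → ℝ} {E F : RISpace} {f : V} (hf : f ∈ sumSpace N₀ N₁) :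
    normL N₀ N₁ θ b E a F f = E.tildeNorm fun t => ENNReal.ofReal (b t) *
      F.tildeNormOn (Ioo 0 t) (weightedK N₀ N₁ θ a f) := if_pos hf

theorem normR_eq {θ : ℝ} {a b : ℝ → ℝ} {E F : RISpace} {f : V} (hf : f ∈ sumSpace N₀ N₁) :
    normR N₀ N₁ θ b E a F f = E.tildeNorm fun t => ENNReal.ofReal (b t) *
      F.tildeNormOn (Ioi t) (weightedK N₀ N₁ θ a f) := if_pos hf

theorem mem_sumSpace_of_normL_lt_top {θ : ℝ} {a b : ℝ → ℝ} {E F : RISpace} {f : V}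
    (h : normL N₀ N₁ θ b E a F f < ∞) : f ∈ sumSpace N₀ N₁ := by
  by_contra hf
  simp [normL, hf] at h

theorem mem_sumSpace_of_normR_lt_top {θ : ℝ} {a b : ℝ → ℝ} {E F : RISpace} {f : V}
    (h : normR N₀ N₁ θ b E a F f < ∞) : f ∈ sumSpace N₀ N₁ := by
  by_contra hf
  simp [normR, hf] at h

end PeetreFunctional

/-! ### Quasi-Banach couples and almost optimal decompositions -/

section QuasiBanach

variable {𝕜 V : Type*} [RCLike 𝕜] [AddCommGroup V] [Module 𝕜 V] [TopologicalSpace V]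

theorem QuasiBanachIn.qnorm_zero (X : QuasiBanachIn 𝕜 V) : X.qnorm 0 = 0 :=
  (X.qnorm_eq_zero_iff 0).2 rfl

theorem QuasiBanachIn.qnorm_neg (X : QuasiBanachIn 𝕜 V) (x : V) : X.qnorm (-x) = X.qnorm x := by
  simpa using X.qnorm_smul (-1) x

theorem exists_common_quasi_triangle (X₀ X₁ : QuasiBanachIn 𝕜 V) :
    ∃ c : ℝ≥0, 1 ≤ c ∧ (∀ x y, X₀.qnorm (x + y) ≤ c * (X₀.qnorm x + X₀.qnorm y)) ∧
      ∀ x y, X₁.qnorm (x + y) ≤ c * (X₁.qnorm x + X₁.qnorm y) := by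
  obtain ⟨C₀, h₀⟩ := X₀.quasi_triangle
  obtain ⟨C₁, h₁⟩ := X₁.quasi_triangle
  refine ⟨max 1 (max C₀ C₁), le_max_left _ _, fun x y => (h₀ x y).trans ?_,
    fun x y => (h₁ x y).trans ?_⟩
  · exact mul_le_mul_left (by exact_mod_cast (le_max_left _ _).trans (le_max_right _ _)) _
  · exact mul_le_mul_left (by exact_mod_cast (le_max_right _ _).trans (le_max_right _ _)) _

/-- Decompositions of arbitrarily small cost put both parts in any given neighbourhood of 0, hence f
as well; in a Hausdorff space this forces f = 0. -/
theorem eq_zero_of_peetreK_eq_zero [IsTopologicalAddGroup V] [T2Space V]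
    (X₀ X₁ : QuasiBanachIn 𝕜 V) {t : ℝ≥0∞} (ht : t ≠ 0) {f : V}
    (h : peetreK X₀.qnorm X₁.qnorm t f = 0) : f = 0 := by
  by_contra hf
  obtain ⟨U, hU, hfU⟩ : ∃ U ∈ 𝓝 (0 : V), f ∉ U :=
    ⟨{f}ᶜ, isOpen_compl_singleton.mem_nhds (by simpa using Ne.symm hf), by simp⟩
  obtain ⟨W, hW, hWU⟩ := exists_nhds_zero_half hU
  obtain ⟨ε₀, hε₀, h₀⟩ := X₀.continuous_embedding W hW
  obtain ⟨ε₁, hε₁, h₁⟩ := X₁.continuous_embedding W hW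
  have hpos : 0 < min ε₀ (t * ε₁) := lt_min hε₀ (pos_iff_ne_zero.2 (mul_ne_zero ht hε₁.ne'))
  obtain ⟨f₀, f₁, -, -, hff, hlt⟩ := exists_of_peetreK_lt (h.trans_lt hpos)
  refine hfU (hff ▸ hWU _ (h₀ _ ?_) _ (h₁ _ ?_))
  · exact (le_self_add.trans_lt hlt).trans_le (min_le_left _ _)
  · exact lt_of_mul_lt_mul_left ((le_add_self.trans_lt hlt).trans_le (min_le_right _ _))
      (zero_le)

/-- Decompositions `f = g + h` that are optimal at `u` up to a constant, with the resulting
bounds on `K(s, g)` and `K(s, h)`. -/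
theorem exists_decomposition [IsTopologicalAddGroup V] [T2Space V] (X₀ X₁ : QuasiBanachIn 𝕜 V)
    {c : ℝ≥0} (hc : 1 ≤ c) (h₀ : ∀ x y, X₀.qnorm (x + y) ≤ c * (X₀.qnorm x + X₀.qnorm y))
    (h₁ : ∀ x y, X₁.qnorm (x + y) ≤ c * (X₁.qnorm x + X₁.qnorm y)) {f : V}
    (hf : f ∈ sumSpace X₀.qnorm X₁.qnorm) {u : ℝ} (hu : 0 < u) (K : V → ℝ → ℝ≥0∞)
    (hK : K = fun f s => peetreK X₀.qnorm X₁.qnorm (ENNReal.ofReal s) f) :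
    ∃ g h, f = g + h ∧ X₀.qnorm g < ∞ ∧ X₁.qnorm h < ∞ ∧
      (∀ s, 0 < s → s ≤ u → K g s ≤ (3 * c : ℝ≥0) * K f s) ∧
      (∀ s, u ≤ s → K g s ≤ (3 * c : ℝ≥0) * K f u) ∧
      (∀ s, 0 < s → s ≤ u → K h s ≤ (3 * c : ℝ≥0) * (ENNReal.ofReal (s / u) * K f u)) ∧
      (∀ s, u ≤ s → K h s ≤ (3 * c : ℝ≥0) * K f s) := by
  have hc' : (1 : ℝ≥0∞) ≤ c := by exact_mod_cast hc
  have hc0 : c ≠ 0 := (zero_lt_one.trans_le hc).ne'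
  have hqc : ∀ f, IsQuasiConcave (K f) := by
    rw [hK]; exact isQuasiConcave_peetreK _ _
  obtain ⟨g, h, hg, hh, hfgh, hle⟩ : ∃ g h, X₀.qnorm g < ∞ ∧ X₁.qnorm h < ∞ ∧ f = g + h ∧
      X₀.qnorm g + ENNReal.ofReal u * X₁.qnorm h ≤ 2 * K f u := by
    -- When K(u,f) = 0 the factor 2 leaves no room for a near-minimizer, but then f = 0 and the
    -- trivial decomposition serves.
    rcases eq_or_ne (K f u) 0 with h0 | h0
    · have hf0 : f = 0 := eq_zero_of_peetreK_eq_zero X₀ X₁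
        (by simpa using hu : ENNReal.ofReal u ≠ 0) (by simpa only [hK] using h0)
      exact ⟨0, 0, by simp [X₀.qnorm_zero], by simp [X₁.qnorm_zero], by simp [hf0],
        by simp [X₀.qnorm_zero, X₁.qnorm_zero]⟩
    · have htop : K f u ≠ ⊤ := by
        rw [hK]; exact (peetreK_lt_top hf ENNReal.ofReal_ne_top).ne
      have hlt : K f u < 2 * K f u := by
        rw [two_mul]
        exact ENNReal.lt_add_right htop h0
      obtain ⟨g, h, hg, hh, hfgh, hlt⟩ := exists_of_peetreK_lt (by simpa only [hK] using hlt)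
      exact ⟨g, h, hg, hh, hfgh, hK ▸ hlt.le⟩
  have hgu : X₀.qnorm g ≤ 2 * K f u := le_self_add.trans hle
  have hhu : ∀ s, 0 ≤ s → ENNReal.ofReal s * X₁.qnorm h ≤
      2 * (ENNReal.ofReal (s / u) * K f u) := by
    intro s hs
    calc ENNReal.ofReal s * X₁.qnorm h
        = ENNReal.ofReal (s / u) * (ENNReal.ofReal u * X₁.qnorm h) := by
          rw [← mul_assoc, ← ENNReal.ofReal_mul (by positivity), div_mul_cancel₀ _ hu.ne']
      _ ≤ ENNReal.ofReal (s / u) * (2 * K f u) := mul_le_mul_right (le_add_self.trans hle) _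
      _ = _ := by ring
  have hKg : ∀ s x, X₀.qnorm x = X₀.qnorm g → K x s ≤ X₀.qnorm g := by
    intro s x hx
    rw [hK]
    refine (peetreK_le (f₀ := x) (f₁ := 0) (hx ▸ hg) (by simp [X₁.qnorm_zero]) (by simp)).trans ?_
    simp [X₁.qnorm_zero, hx]
  have hKh : ∀ s x, X₁.qnorm x = X₁.qnorm h → K x s ≤ ENNReal.ofReal s * X₁.qnorm h := by
    intro s x hx
    rw [hK]
    refine (peetreK_le (f₀ := 0) (f₁ := x) (by simp [X₀.qnorm_zero]) (hx ▸ hh) (by simp)).trans ?_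
    simp [X₀.qnorm_zero, hx]
  have hadd : ∀ s x y, K (x + y) s ≤ c * (K x s + K y s) := by
    intro s x y
    rw [hK]
    exact peetreK_add_le hc0 h₀ h₁ x y
  have hdiv : ∀ s, 0 < s → s ≤ u → ENNReal.ofReal (s / u) * K f u ≤ K f s := by
    intro s hs hsu
    calc ENNReal.ofReal (s / u) * K f u
        ≤ ENNReal.ofReal (s / u) * (ENNReal.ofReal (u / s) * K f s) := by
          gcongr; exact (hqc f).le_div_mul s u hs hsu
      _ = K f s := by
          rw [← mul_assoc, ← ENNReal.ofReal_mul (by positivity), div_mul_div_cancel₀ hu.ne',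
            div_self hs.ne', ENNReal.ofReal_one, one_mul]
  have h23 : ∀ x : ℝ≥0∞, 2 * x ≤ (3 * c : ℝ≥0) * x := by
    intro x
    push_cast
    gcongr
    calc (2 : ℝ≥0∞) ≤ 3 * 1 := by norm_num
      _ ≤ 3 * c := by gcongr
  -- The constant 3c: writing g = f - h or h = f - g costs c from the quasi-triangle inequality,
  -- with 1 from f and 2 from the almost optimal part.
  have h3 : ∀ x : ℝ≥0∞, c * (x + 2 * x) = (3 * c : ℝ≥0) * x := by
    intro x
    push_cast
    ring
  refine ⟨g, h, hfgh, hg, hh, fun s hs hsu => ?_, fun s hus => ?_, fun s hs hsu => ?_,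
    fun s hus => ?_⟩
  · rw [show g = f + -h by rw [hfgh]; abel, ← h3]
    refine (hadd s f (-h)).trans ?_
    gcongr
    refine (hKh s _ (X₁.qnorm_neg h)).trans ((hhu s hs.le).trans ?_)
    gcongr
    exact hdiv s hs hsu
  · exact ((hKg s g rfl).trans hgu).trans (h23 _)
  · exact ((hKh s h rfl).trans (hhu s hs.le)).trans (h23 _)
  · rw [show h = f + -g by rw [hfgh]; abel, ← h3]
    refine (hadd s f (-g)).trans ?_
    gcongr
    refine (hKg s _ (X₀.qnorm_neg g)).trans (hgu.trans ?_)
    gcongr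
    exact (hqc f).mono hus

end QuasiBanach

/-! ### The Holmstedt formula -/

theorem theorem3p4 {𝕜 V : Type*} [RCLike 𝕜] [AddCommGroup V] [Module 𝕜 V] [TopologicalSpace V]
    [IsTopologicalAddGroup V] [ContinuousSMul 𝕜 V] [T2Space V] (X₀ X₁ : QuasiBanachIn 𝕜 V)
    (θ₀ θ₁ : ℝ) (hθ₀ : 0 < θ₀) (hθ : θ₀ < θ₁) (hθ₁ : θ₁ < 1)
    (E₀ E₁ F₀ F₁ : RISpace) (a₀ a₁ b₀ b₁ : ℝ → ℝ)
    (ha₀ : SlowlyVarying a₀) (ha₁ : SlowlyVarying a₁)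
    (hb₀ : SlowlyVarying b₀) (hb₁ : SlowlyVarying b₁)
    (hE₀ : E₀.tildeNormOn (Ioi 1) (fun t => ENNReal.ofReal (b₀ t)) < ∞)
    (hE₁ : E₁.tildeNormOn (Ioo 0 1) (fun t => ENNReal.ofReal (b₁ t)) < ∞)
    (ρ : ℝ → ℝ≥0∞)
    (hρ : ∀ u, 0 < u → ρ u = ENNReal.ofReal (u ^ (θ₁ - θ₀)) *
      ((ENNReal.ofReal (a₀ u) * E₀.tildeNormOn (Ioi u) (fun t => ENNReal.ofReal (b₀ t))) /
        (ENNReal.ofReal (a₁ u) * E₁.tildeNormOn (Ioo 0 u) (fun t => ENNReal.ofReal (b₁ t)))))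
    (Y₀ Y₁ : V → ℝ≥0∞)
    (hY₀ : Y₀ = normL X₀.qnorm X₁.qnorm θ₀ b₀ E₀ a₀ F₀)
    (hY₁ : Y₁ = normR X₀.qnorm X₁.qnorm θ₁ b₁ E₁ a₁ F₁)
    (rhs : V → ℝ → ℝ≥0∞)
    (hrhs : ∀ f u, rhs f u =
      E₀.tildeNormOn (Ioo 0 u) (fun t => ENNReal.ofReal (b₀ t) *
          F₀.tildeNormOn (Ioo 0 t) (weightedK X₀.qnorm X₁.qnorm θ₀ a₀ f))
        + E₀.tildeNormOn (Ioi u) (fun t => ENNReal.ofReal (b₀ t)) *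
          F₀.tildeNormOn (Ioo 0 u) (weightedK X₀.qnorm X₁.qnorm θ₀ a₀ f)
        + ρ u * E₁.tildeNormOn (Ioo 0 u) (fun t => ENNReal.ofReal (b₁ t)) *
          F₁.tildeNormOn (Ioi u) (weightedK X₀.qnorm X₁.qnorm θ₁ a₁ f)
        + ρ u * E₁.tildeNormOn (Ioi u) (fun t => ENNReal.ofReal (b₁ t) *
          F₁.tildeNormOn (Ioi t) (weightedK X₀.qnorm X₁.qnorm θ₁ a₁ f))) :
    (∀ u, 0 < u → 0 < ρ u ∧ ρ u < ∞) ∧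
      ∃ C : ℝ≥0, 0 < C ∧ ∀ f ∈ sumSpace Y₀ Y₁, ∀ u, 0 < u →
        peetreK Y₀ Y₁ (ρ u) f ≤ C * rhs f u ∧ rhs f u ≤ C * peetreK Y₀ Y₁ (ρ u) f := by
  set A₀ : ℝ → ℝ≥0∞ := fun t => ENNReal.ofReal (a₀ t)
  set A₁ : ℝ → ℝ≥0∞ := fun t => ENNReal.ofReal (a₁ t)
  set B₀ : ℝ → ℝ≥0∞ := fun t => ENNReal.ofReal (b₀ t)
  set B₁ : ℝ → ℝ≥0∞ := fun t => ENNReal.ofReal (b₁ t)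
  set T₀ : ℝ → ℝ≥0∞ := fun u => E₀.tildeNormOn (Ioi u) B₀
  set T₁ : ℝ → ℝ≥0∞ := fun u => E₁.tildeNormOn (Ioo 0 u) B₁
  let K : V → ℝ → ℝ≥0∞ := fun f s => peetreK X₀.qnorm X₁.qnorm (ENNReal.ofReal s) f
  have hA₀ : IsSlowWeight A₀ := ha₀.isSlowWeight
  have hA₁ : IsSlowWeight A₁ := ha₁.isSlowWeight
  have hB₀ : IsSlowWeight B₀ := hb₀.isSlowWeight
  have hB₁ : IsSlowWeight B₁ := hb₁.isSlowWeight
  have hmeas : ∀ {b : ℝ → ℝ}, SlowlyVarying b →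
      AEMeasurable (fun t => ENNReal.ofReal (b t)) homHalfLine := fun hb =>
    (hb.aemeasurable.mono_ac homHalfLine_absolutelyContinuous).ennreal_ofReal
  have htop : ∀ b : ℝ → ℝ, ∀ u, 0 < u → ENNReal.ofReal (b u) ≠ ⊤ := fun _ _ _ =>
    ENNReal.ofReal_ne_top
  have hpos : ∀ {b : ℝ → ℝ}, SlowlyVarying b → ∀ u, 0 < u → ENNReal.ofReal (b u) ≠ 0 :=
    fun hb u hu => by simpa using hb.pos u hu
  have hT₀ : IsSlowWeight T₀ := hB₀.tildeNormOn_Ioi E₀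
  have hT₁ : IsSlowWeight T₁ := hB₁.tildeNormOn_Ioo E₁
  have hT₀top : ∀ u, 0 < u → T₀ u ≠ ⊤ := fun u hu => hT₀.ne_top one_pos hu hE₀.ne
  have hT₁top : ∀ u, 0 < u → T₁ u ≠ ⊤ := fun u hu => hT₁.ne_top one_pos hu hE₁.ne
  have hT₀pos : ∀ u, 0 < u → T₀ u ≠ 0 := by
    obtain ⟨D, hD⟩ := hB₀.exists_le_tildeNormOn E₀
    intro u hu h
    have := (hD u hu).2
    rw [show E₀.tildeNormOn (Ioi u) B₀ = 0 from h, mul_zero] at this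
    exact hpos hb₀ u hu (le_zero_iff.1 this)
  have hT₁pos : ∀ u, 0 < u → T₁ u ≠ 0 := by
    obtain ⟨D, hD⟩ := hB₁.exists_le_tildeNormOn E₁
    intro u hu h
    have := (hD u hu).1
    rw [show E₁.tildeNormOn (Ioo 0 u) B₁ = 0 from h, mul_zero] at this
    exact hpos hb₁ u hu (le_zero_iff.1 this)
  have hAT₀0 : ∀ u, 0 < u → A₀ u * T₀ u ≠ 0 := fun u hu =>
    mul_ne_zero (hpos ha₀ u hu) (hT₀pos u hu)
  have hAT₁0 : ∀ u, 0 < u → A₁ u * T₁ u ≠ 0 := fun u hu =>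
    mul_ne_zero (hpos ha₁ u hu) (hT₁pos u hu)
  have hAT₀top : ∀ u, 0 < u → A₀ u * T₀ u ≠ ⊤ := fun u hu =>
    ENNReal.mul_ne_top (htop a₀ u hu) (hT₀top u hu)
  have hAT₁top : ∀ u, 0 < u → A₁ u * T₁ u ≠ ⊤ := fun u hu =>
    ENNReal.mul_ne_top (htop a₁ u hu) (hT₁top u hu)
  have hρ' : ∀ u, 0 < u → ρ u = ENNReal.ofReal (u ^ (θ₁ - θ₀)) *
      ((A₀ u * T₀ u) * (A₁ u * T₁ u)⁻¹) := fun u hu => hρ u hu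
  have hρpos : ∀ u, 0 < u → 0 < ρ u ∧ ρ u < ∞ := by
    intro u hu
    have hp : 0 < u ^ (θ₁ - θ₀) := Real.rpow_pos_of_pos hu _
    rw [hρ' u hu, pos_iff_ne_zero, lt_top_iff_ne_top]
    exact ⟨mul_ne_zero (by simpa using hp) (mul_ne_zero (hAT₀0 u hu)
        (ENNReal.inv_ne_zero.2 (hAT₁top u hu))),
      ENNReal.mul_ne_top ENNReal.ofReal_ne_top (ENNReal.mul_ne_top (hAT₀top u hu)
        (ENNReal.inv_ne_top.2 (hAT₁0 u hu)))⟩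
  refine ⟨hρpos, ?_⟩
  have hrhs' : ∀ f u, rhs f u = leftTerm E₀ F₀ B₀ (powerWeight θ₀ A₀ (K f)) u +
      ρ u * rightTerm E₁ F₁ B₁ (powerWeight θ₁ A₁ (K f)) u := by
    intro f u
    rw [hrhs, leftTerm, rightTerm, mul_add, ← mul_assoc, ← add_assoc]
    rfl
  have hqc : ∀ f, IsQuasiConcave (K f) := isQuasiConcave_peetreK _ _
  have hδ : 0 < θ₁ - θ₀ := sub_pos.2 hθ
  have hθ₁0 : 0 < θ₁ := hθ₀.trans hθ
  obtain ⟨c, hc1, hc₀, hc₁⟩ := exists_common_quasi_triangle X₀ X₁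
  have hc0 : c ≠ 0 := (zero_lt_one.trans_le hc1).ne'
  have hYL : ∀ f ∈ sumSpace X₀.qnorm X₁.qnorm, Y₀ f = E₀.tildeNorm fun t =>
      B₀ t * F₀.tildeNormOn (Ioo 0 t) (powerWeight θ₀ A₀ (K f)) := fun f hf => by
    rw [hY₀, normL_eq hf]; rfl
  have hYR : ∀ f ∈ sumSpace X₀.qnorm X₁.qnorm, Y₁ f = E₁.tildeNorm fun t =>
      B₁ t * F₁.tildeNormOn (Ioi t) (powerWeight θ₁ A₁ (K f)) := fun f hf => by
    rw [hY₁, normR_eq hf]; rfl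
  have hY₀mem : ∀ f, Y₀ f < ∞ → f ∈ sumSpace X₀.qnorm X₁.qnorm := fun f hf =>
    mem_sumSpace_of_normL_lt_top (hY₀ ▸ hf)
  have hY₁mem : ∀ f, Y₁ f < ∞ → f ∈ sumSpace X₀.qnorm X₁.qnorm := fun f hf =>
    mem_sumSpace_of_normR_lt_top (hY₁ ▸ hf)
  obtain ⟨P₀, hP₀⟩ := exists_left_upper E₀ F₀ hθ₀ hA₀ (hmeas ha₀) (htop a₀) (hmeas hb₀) hT₀pos
  obtain ⟨P₁, hP₁⟩ := exists_right_upper E₁ F₁ hθ₁0 hθ₁ hA₁ (hmeas ha₁) (htop a₁) (hmeas hb₁)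
    hT₁pos
  have hw₀ : IsSlowWeight fun s => A₀ s * (A₁ s * T₁ s)⁻¹ := hA₀.mul (hA₁.mul hT₁).inv
  have hw₁ : IsSlowWeight fun s => A₁ s * (A₀ s * T₀ s)⁻¹ := hA₁.mul (hA₀.mul hT₀).inv
  obtain ⟨Q₀, hQ₀⟩ := exists_leftTerm_le_of_le E₀ F₀ hδ hw₀
    (fun u hu => ENNReal.mul_ne_top (htop a₀ u hu) (ENNReal.inv_ne_top.2 (hAT₁0 u hu)))
    hB₀ (htop b₀)
  obtain ⟨Q₁, hQ₁⟩ := exists_rightTerm_le_of_le E₁ F₁ hδ hw₁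
    (fun u hu => ENNReal.mul_ne_top (htop a₁ u hu) (ENNReal.inv_ne_top.2 (hAT₀0 u hu)))
    hB₁ (htop b₁)
  obtain ⟨D₀, hD₀⟩ := exists_powerWeight_le F₀ hθ₀.le hA₀
  obtain ⟨D₁, hD₁⟩ := exists_powerWeight_le F₁ hθ₁0.le hA₁
  let M : ℝ≥0 := P₀ * (3 * c) + P₁ * (3 * c)
  let N : ℝ≥0 := c * (2 + Q₀ * D₁ + Q₁ * D₀)
  have hM₀ : P₀ * (3 * c) ≤ M := le_self_add
  have hM₁ : P₁ * (3 * c) ≤ M := le_add_self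
  refine ⟨1 + M + N, by positivity, fun f hf u hu => ⟨?_, ?_⟩⟩
  -- A finite right-hand side is what makes g + h admissible, since it gives finite norms of g in Y₀
  -- and of h in Y₁.
  · rcases eq_or_ne (rhs f u) ⊤ with hr | hr
    · rw [hr, ENNReal.mul_top (by simp)]
      exact le_top
    obtain ⟨y₀, y₁, hy₀, hy₁, hfy⟩ := hf
    have hfX : f ∈ sumSpace X₀.qnorm X₁.qnorm :=
      hfy ▸ add_mem_sumSpace hc₀ hc₁ (hY₀mem y₀ hy₀) (hY₁mem y₁ hy₁)
    have hKu : K f u ≠ ⊤ := (peetreK_lt_top hfX ENNReal.ofReal_ne_top).ne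
    obtain ⟨g, h, hfgh, hg, hh, hg₁, hg₂, hh₁, hh₂⟩ :=
      exists_decomposition X₀ X₁ hc1 hc₀ hc₁ hfX hu K rfl
    have hgX : g ∈ sumSpace X₀.qnorm X₁.qnorm :=
      ⟨g, 0, hg, by simp [X₁.qnorm_zero], by simp⟩
    have hhX : h ∈ sumSpace X₀.qnorm X₁.qnorm :=
      ⟨0, h, by simp [X₀.qnorm_zero], hh, by simp⟩
    have hYg : Y₀ g ≤ M * leftTerm E₀ F₀ B₀ (powerWeight θ₀ A₀ (K f)) u := by
      rw [hYL g hgX]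
      refine (hP₀ _ _ _ u hu (hqc f) hKu hg₁ hg₂).trans (mul_le_mul_left ?_ _)
      exact_mod_cast hM₀
    have hYh : Y₁ h ≤ M * rightTerm E₁ F₁ B₁ (powerWeight θ₁ A₁ (K f)) u := by
      rw [hYR h hhX]
      refine (hP₁ _ _ _ u hu (hqc f) hKu hh₁ hh₂).trans (mul_le_mul_left ?_ _)
      exact_mod_cast hM₁
    rw [hrhs'] at hr ⊢
    obtain ⟨hr₀, hr₁⟩ := ENNReal.add_ne_top.1 hr
    have hr₁' : rightTerm E₁ F₁ B₁ (powerWeight θ₁ A₁ (K f)) u ≠ ⊤ := fun h => by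
      rw [h, ENNReal.mul_top (hρpos u hu).1.ne'] at hr₁
      exact hr₁ rfl
    refine (peetreK_le (hYg.trans_lt (ENNReal.mul_lt_top ENNReal.coe_lt_top hr₀.lt_top))
      (hYh.trans_lt (ENNReal.mul_lt_top ENNReal.coe_lt_top hr₁'.lt_top)) hfgh).trans ?_
    calc Y₀ g + ρ u * Y₁ h
        ≤ M * leftTerm E₀ F₀ B₀ (powerWeight θ₀ A₀ (K f)) u +
          ρ u * (M * rightTerm E₁ F₁ B₁ (powerWeight θ₁ A₁ (K f)) u) := by gcongr
      _ = M * (leftTerm E₀ F₀ B₀ (powerWeight θ₀ A₀ (K f)) u +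
          ρ u * rightTerm E₁ F₁ B₁ (powerWeight θ₁ A₁ (K f)) u) := by ring
      _ ≤ _ := by
        gcongr
        exact_mod_cast le_add_right (le_add_self : M ≤ 1 + M)
  · have hC0 : ((1 + M + N : ℝ≥0) : ℝ≥0∞) ≠ 0 := by simp
    rw [← ENNReal.inv_mul_le_iff hC0 ENNReal.coe_ne_top]
    refine le_peetreK fun g h hg hh hfgh => ?_
    rw [ENNReal.inv_mul_le_iff hC0 ENNReal.coe_ne_top]
    have hgX := hY₀mem g hg
    have hhX := hY₁mem h hh
    have hKadd : ∀ s, K f s ≤ c * (K g s + K h s) := fun s =>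
      hfgh ▸ peetreK_add_le hc0 hc₀ hc₁ g h
    have hpw : ∀ θ (A : ℝ → ℝ≥0∞) s, powerWeight θ A (K f) s ≤
        c * (powerWeight θ A (K g) s + powerWeight θ A (K h) s) := by
      intro θ A s
      refine (mul_le_mul_right (hKadd s) _).trans (le_of_eq ?_)
      unfold powerWeight
      ring
    have hpm : ∀ θ (A : ℝ → ℝ≥0∞) f, AEMeasurable A homHalfLine →
        AEMeasurable (powerWeight θ A (K f)) homHalfLine := fun θ A f hA =>
      aemeasurable_powerWeight hA (hqc f).mono
    have hleft := leftTerm_le_add E₀ F₀ c u (hmeas hb₀) (hpm θ₀ A₀ g (hmeas ha₀))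
      (hpm θ₀ A₀ h (hmeas ha₀)) fun s _ => hpw θ₀ A₀ s
    have hright := rightTerm_le_add E₁ F₁ c u (hmeas hb₁) (hpm θ₁ A₁ g (hmeas ha₁))
      (hpm θ₁ A₁ h (hmeas ha₁)) fun s _ => hpw θ₁ A₁ s
    have hLg : leftTerm E₀ F₀ B₀ (powerWeight θ₀ A₀ (K g)) u ≤ 2 * Y₀ g := by
      rw [hYL g hgX]
      exact leftTerm_le E₀ F₀ u B₀ _
    have hRh : rightTerm E₁ F₁ B₁ (powerWeight θ₁ A₁ (K h)) u ≤ 2 * Y₁ h := by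
      rw [hYR h hhX]
      exact rightTerm_le E₁ F₁ u B₁ _
    -- First cross term: T₁(s) times the inner norm over (s,∞) is at most the norm of h in Y₁, which
    -- gives the pointwise bound on K(s,h). The weight produced at u is ρ(u).
    have hLh : leftTerm E₀ F₀ B₀ (powerWeight θ₀ A₀ (K h)) u ≤ Q₀ * (D₁ * Y₁ h * ρ u) := by
      refine (hQ₀ _ (D₁ * Y₁ h) u (ENNReal.mul_ne_top ENNReal.coe_ne_top hh.ne) hu
        fun s hs => ?_).trans (le_of_eq ?_)
      · refine powerWeight_le_of_mul_le (θ := θ₁) hs (hAT₁0 s hs) (hAT₁top s hs) ?_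
        rw [hYR h hhX]
        calc powerWeight θ₁ A₁ (K h) s * T₁ s
            ≤ D₁ * F₁.tildeNormOn (Ioi s) (powerWeight θ₁ A₁ (K h)) * T₁ s := by
              gcongr; exact (hD₁ _ (hqc h) s hs).2
          _ = D₁ * (T₁ s * F₁.tildeNormOn (Ioi s) (powerWeight θ₁ A₁ (K h))) := by ring
          _ ≤ _ := by gcongr; exact tildeNormOn_Ioo_mul_le E₁ F₁ s B₁ _
      · rw [hρ' u hu]
        ring
    -- Second cross term: the estimate produces the reciprocal of ρ(u), which cancels the factor in
    -- front.
    have hRg : ρ u * rightTerm E₁ F₁ B₁ (powerWeight θ₁ A₁ (K g)) u ≤ Q₁ * (D₀ * Y₀ g) := by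
      have h1 := hQ₁ (powerWeight θ₁ A₁ (K g)) (D₀ * Y₀ g) u
        (ENNReal.mul_ne_top ENNReal.coe_ne_top hg.ne) hu fun s hs => ?_
      · refine (mul_le_mul_right h1 _).trans (le_of_eq ?_)
        have hone : ENNReal.ofReal (u ^ (θ₁ - θ₀)) * ENNReal.ofReal (u ^ (-(θ₁ - θ₀))) = 1 := by
          rw [← ENNReal.ofReal_mul (by positivity), ← Real.rpow_add hu, add_neg_cancel,
            Real.rpow_zero, ENNReal.ofReal_one]
        rw [hρ' u hu]
        calc _ = Q₁ * (D₀ * Y₀ g) *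
              (ENNReal.ofReal (u ^ (θ₁ - θ₀)) * ENNReal.ofReal (u ^ (-(θ₁ - θ₀)))) *
              ((A₀ u * T₀ u) * (A₀ u * T₀ u)⁻¹) * ((A₁ u * T₁ u) * (A₁ u * T₁ u)⁻¹) := by ring
          _ = _ := by
            rw [hone, ENNReal.mul_inv_cancel (hAT₀0 u hu) (hAT₀top u hu),
              ENNReal.mul_inv_cancel (hAT₁0 u hu) (hAT₁top u hu), mul_one, mul_one, mul_one]
      · rw [neg_sub]
        refine powerWeight_le_of_mul_le (θ := θ₀) hs (hAT₀0 s hs) (hAT₀top s hs) ?_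
        rw [hYL g hgX]
        calc powerWeight θ₀ A₀ (K g) s * T₀ s
            ≤ D₀ * F₀.tildeNormOn (Ioo 0 s) (powerWeight θ₀ A₀ (K g)) * T₀ s := by
              gcongr; exact (hD₀ _ (hqc g) s hs).1
          _ = D₀ * (T₀ s * F₀.tildeNormOn (Ioo 0 s) (powerWeight θ₀ A₀ (K g))) := by ring
          _ ≤ _ := by gcongr; exact tildeNormOn_Ioi_mul_le E₀ F₀ s B₀ _
    rw [hrhs']
    calc leftTerm E₀ F₀ B₀ (powerWeight θ₀ A₀ (K f)) u +
          ρ u * rightTerm E₁ F₁ B₁ (powerWeight θ₁ A₁ (K f)) u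
        ≤ c * (leftTerm E₀ F₀ B₀ (powerWeight θ₀ A₀ (K g)) u +
            leftTerm E₀ F₀ B₀ (powerWeight θ₀ A₀ (K h)) u) +
          ρ u * (c * (rightTerm E₁ F₁ B₁ (powerWeight θ₁ A₁ (K g)) u +
            rightTerm E₁ F₁ B₁ (powerWeight θ₁ A₁ (K h)) u)) := by gcongr
      _ = c * (leftTerm E₀ F₀ B₀ (powerWeight θ₀ A₀ (K g)) u +
            leftTerm E₀ F₀ B₀ (powerWeight θ₀ A₀ (K h)) u +
          ρ u * rightTerm E₁ F₁ B₁ (powerWeight θ₁ A₁ (K g)) u +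
          ρ u * rightTerm E₁ F₁ B₁ (powerWeight θ₁ A₁ (K h)) u) := by ring
      _ ≤ c * (2 * Y₀ g + Q₀ * (D₁ * Y₁ h * ρ u) + Q₁ * (D₀ * Y₀ g) + ρ u * (2 * Y₁ h)) := by
        gcongr
      _ = c * ((2 + Q₁ * D₀) * Y₀ g + (2 + Q₀ * D₁) * (ρ u * Y₁ h)) := by ring
      _ ≤ c * ((2 + Q₀ * D₁ + Q₁ * D₀) * Y₀ g + (2 + Q₀ * D₁ + Q₁ * D₀) * (ρ u * Y₁ h)) := by
        refine mul_le_mul_right (add_le_add (mul_le_mul_left ?_ _) (mul_le_mul_left ?_ _)) _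
        · exact add_le_add (le_add_right le_rfl) le_rfl
        · exact le_add_right le_rfl
      _ = N * (Y₀ g + ρ u * Y₁ h) := by
        simp only [N]
        push_cast
        ring
      _ ≤ _ := by
        gcongr
        exact_mod_cast (le_add_self : N ≤ 1 + M + N)
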